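/- **Theorem 1.1 (Length compactness theorem).** Let $F$ be a free group of finite rank $k$ with a fixed free basis $\Sigma$, and let $A=\Sigma\cup\Sigma^{-1}$. Let $\partial F$ be the set of freely reduced right-infinite words in $A$, and let $\partial^2F=\{(x,y)\in\partial F\times\partial F: x\ne y\}$, identified with the set of oriented bi-infinite geodesics of the Cayley graph of $F$. Every automorphism $\Phi$ of $F$ extends to a homeomorphism of $\partial F$, still denoted $\Phi$, and acts on $\partial^2F$ by $\Phi\times\Phi$. The uniform current $\eta_A$ is the Borel measure on $\partial^2F$ such that, for all $g\neq h$ in $F$, the set of geodesics passing first through $g$ and then through $h$ has measure $$\frac{1}{2k(2k-1)^{|g^{-1}h|-1}},$$ where $|\cdot|$ is the word length. The length of $\Phi\in\mathrm{Aut}(F)$ is $L(\Phi)=\eta_A(\Phi^{-1}(B))$, where $B\subset\partial^2F$ is the set of geodesics passing through $1$. 1. For every sequence $(\Phi_n)$ in $\mathrm{Aut}(F)$ there are a subsequence $(\Phi_{n_i})$ and elements $v_i\in F$ such that one of the following holds for the automorphisms $\Psi_i\colon x\mapsto v_i\Phi_{n_i}(x)v_i^{-1}$: * the sequence $(\Psi_i)$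 is constant, $\Psi_i=\Phi$ for all $i$, for some automorphism $\Phi$; * $L(\Phi_{n_i})\to\infty$. The two alternatives exclude each other: for no subsequence $(\Phi_{n_i})$ and no choice of $v_i\in F$ can $(\Psi_i)$ have a constant subsequence while $L(\Phi_{n_i})\to\infty$. 2. (Reformulation.) For every $M\in\mathbb R$ the set $\{[\Phi]\in\mathrm{Out}(F): L(\Phi)<M\}$ is finite. 3. (Reformulation.) If $(\Phi_n)$ is a sequence in $\mathrm{Aut}(F)$ and there is $w\in F$ such that the cyclically reduced length of $\Phi_n(w)$ tends to $\infty$, then $L(\Phi_n)\to\infty$. -/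

import Mathlib

open MeasureTheory ProbabilityTheory Filter
open scoped ENNReal Topology

namespace FreeLength

noncomputable section

/-- The boundary at infinity of the free group on `Fin k`: freely reduced right-infinite words in
the letters and their inverses. The letter `(a, true)` is the generator `a` and `(a, false)` is its
inverse, as in `FreeGroup`. The Borel structure of the Cantor topology is the one induced by the
product of the discrete letter sets. -/
abbrev Boundary (k : ℕ) : Type :=
  {x : ℕ → Fin k × Bool // ∀ n, (x n).1 = (x (n + 1)).1 → (x n).2 = (x (n + 1)).2}

/-- The first `m` letters of a ray. -/
def Boundary.pre {k : ℕ} (x : Boundary k) (m : ℕ) : List (Fin k × Bool) :=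
  (List.range m).map x.1

/-- The `m`-th vertex of the ray issuing from the identity of the Cayley graph. -/
def Boundary.vertex {k : ℕ} (x : Boundary k) (m : ℕ) : FreeGroup (Fin k) :=
  FreeGroup.mk (x.pre m)

/-- Convergence of a sequence of group elements to a boundary point: each finite initial segment
of the ray is eventually an initial segment of the reduced words. -/
def TendsToEnd {k : ℕ} (u : ℕ → FreeGroup (Fin k)) (x : Boundary k) : Prop :=
  ∀ m, ∀ᶠ n in atTop, x.pre m <+: (u n).toWord

lemma Boundary.pre_length {k : ℕ} (x : Boundary k) (m : ℕ) : (x.pre m).length = m := by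
  simp [pre]

lemma Boundary.isReduced_pre {k : ℕ} (x : Boundary k) (m : ℕ) :
    FreeGroup.IsReduced (x.pre m) := by
  rw [FreeGroup.IsReduced, List.isChain_iff_getElem]
  intro i hi
  simpa [pre] using x.2 i

lemma Boundary.toWord_vertex {k : ℕ} (x : Boundary k) (m : ℕ) :
    (x.vertex m).toWord = x.pre m := by
  rw [vertex, FreeGroup.toWord_mk, (x.isReduced_pre m).reduce_eq]

lemma Boundary.norm_vertex {k : ℕ} (x : Boundary k) (m : ℕ) : (x.vertex m).norm = m := by
  rw [FreeGroup.norm, toWord_vertex, pre_length]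

lemma Boundary.pre_take {k : ℕ} (x : Boundary k) {m n : ℕ} (h : m ≤ n) :
    (x.pre n).take m = x.pre m := by
  simp [pre, ← List.map_take, List.take_range, h]

lemma Boundary.pre_prefix {k : ℕ} (x : Boundary k) {m n : ℕ} (h : m ≤ n) :
    x.pre m <+: x.pre n := by
  rw [← x.pre_take h]; exact List.take_prefix _ _

lemma Boundary.eq_pre {k : ℕ} (x : Boundary k) {L : List (Fin k × Bool)} {n : ℕ}
    (h : L <+: x.pre n) : L = x.pre L.length := by
  have h2 := h.length_le
  rw [x.pre_length] at h2
  rw [← x.pre_take h2]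
  exact List.prefix_iff_eq_take.1 h

lemma exists_split {β : Type*} (L M : List β) : ∃ p s t, L = p ++ s ∧ M = p ++ t ∧
    ∀ u ∈ s.head?, ∀ v ∈ t.head?, u ≠ v := by
  induction L generalizing M with
  | nil => exact ⟨[], [], M, by simp⟩
  | cons a L ih =>
    cases M with
    | nil => exact ⟨[], a :: L, [], by simp⟩
    | cons b M =>
      by_cases h : a = b
      · subst h
        obtain ⟨p, s, t, rfl, rfl, h⟩ := ih M
        exact ⟨a :: p, s, t, by simp, by simp, h⟩
      · exact ⟨[], a :: L, b :: M, by simp, by simp, by simpa using h⟩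

lemma norm_inv_mul_le {α : Type*} [DecidableEq α] {a b : FreeGroup α} {p s t : List (α × Bool)}
    (ha : a.toWord = p ++ s) (hb : b.toWord = p ++ t) :
    (a⁻¹ * b).norm ≤ s.length + t.length := by
  rw [← a.mk_toWord, ← b.mk_toWord, ha, hb, ← FreeGroup.mul_mk, ← FreeGroup.mul_mk]
  rw [show (FreeGroup.mk p * FreeGroup.mk s)⁻¹ * (FreeGroup.mk p * FreeGroup.mk t) =
    FreeGroup.mk (FreeGroup.invRev s ++ t) by rw [← FreeGroup.mul_mk, ← FreeGroup.inv_mk]; group]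
  refine FreeGroup.norm_mk_le.trans ?_
  simp

lemma norm_inv_mul_eq {α : Type*} [DecidableEq α] {a b : FreeGroup α} {p s t : List (α × Bool)}
    (ha : a.toWord = p ++ s) (hb : b.toWord = p ++ t)
    (h : ∀ u ∈ s.head?, ∀ v ∈ t.head?, u ≠ v) :
    (a⁻¹ * b).norm = s.length + t.length := by
  have hs : FreeGroup.IsReduced s :=
    (ha ▸ FreeGroup.isReduced_toWord (x := a)).infix ⟨p, [], by simp⟩
  have ht : FreeGroup.IsReduced t :=
    (hb ▸ FreeGroup.isReduced_toWord (x := b)).infix ⟨p, [], by simp⟩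
  have hs' : FreeGroup.IsReduced (FreeGroup.invRev s) := by
    rw [FreeGroup.isReduced_iff_reduce_eq, FreeGroup.reduce_invRev, hs.reduce_eq]
  have hr : FreeGroup.IsReduced (FreeGroup.invRev s ++ t) := by
    rw [FreeGroup.IsReduced, List.isChain_append]
    refine ⟨hs', ht, ?_⟩
    intro u hu v hv h1
    cases s with
    | nil => simp at hu
    | cons e s =>
      have hu' : u = (e.1, !e.2) := by simpa [FreeGroup.invRev, eq_comm] using hu
      have := h e (by simp) v hv
      subst hu'
      by_contra h3
      apply this
      ext
      · simp at h1; simp [h1]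
      · simp at h3; exact h3
  rw [← a.mk_toWord, ← b.mk_toWord, ha, hb, ← FreeGroup.mul_mk, ← FreeGroup.mul_mk]
  rw [show (FreeGroup.mk p * FreeGroup.mk s)⁻¹ * (FreeGroup.mk p * FreeGroup.mk t) =
    FreeGroup.mk (FreeGroup.invRev s ++ t) by rw [← FreeGroup.mul_mk, ← FreeGroup.inv_mk]; group]
  rw [FreeGroup.norm, FreeGroup.toWord_mk, hr.reduce_eq]
  simp

lemma take_eq_of_norm_le {α : Type*} [DecidableEq α] {a b : FreeGroup α} {m C : ℕ}
    (h : (a⁻¹ * b).norm ≤ C) (ha : m + C ≤ a.norm) : a.toWord.take m = b.toWord.take m := by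
  obtain ⟨p, s, t, h1, h2, h3⟩ := exists_split a.toWord b.toWord
  have h4 := norm_inv_mul_eq h1 h2 h3
  have h5 : a.norm = p.length + s.length := by rw [FreeGroup.norm, h1]; simp
  have h6 : m ≤ p.length := by omega
  rw [h1, h2, List.take_append_of_le_length h6, List.take_append_of_le_length h6]

lemma tight {α : Type*} [DecidableEq α] {a g b : FreeGroup α}
    (h : (a⁻¹ * g).norm + (g⁻¹ * b).norm = (a⁻¹ * b).norm) :
    (g.toWord <+: a.toWord ∨ g.toWord <+: b.toWord) ∧
      ∀ c : List (α × Bool), c <+: a.toWord → c <+: b.toWord → c.length ≤ g.norm := by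
  have key : g.toWord <+: a.toWord ∨ g.toWord <+: b.toWord := by
    obtain ⟨p, s, t, h1, h2, h3⟩ := exists_split g.toWord a.toWord
    obtain ⟨p', s', t', h1', h2', h3'⟩ := exists_split g.toWord b.toWord
    have h4 := norm_inv_mul_eq h1 h2 h3
    have h4' := norm_inv_mul_eq h1' h2' h3'
    have h5 : (a⁻¹ * g).norm = (g⁻¹ * a).norm := by
      rw [← FreeGroup.norm_inv_eq]; congr 1; group
    have h6 : p ++ s = p' ++ s' := h1.symm.trans h1'
    have h7 := congrArg List.length h6
    simp only [List.length_append] at h7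
    rcases Nat.eq_zero_or_pos s.length with h8 | h8
    · left; rw [h1, h2, List.length_eq_zero_iff.1 h8]; simp
    rcases Nat.eq_zero_or_pos s'.length with h9 | h9
    · right; rw [h1', h2', List.length_eq_zero_iff.1 h9]; simp
    exfalso
    rcases le_total p.length p'.length with hl | hl
    · obtain ⟨r, rfl⟩ := List.prefix_of_prefix_length_le (l₃ := p ++ s) ⟨s, rfl⟩
        (h6 ▸ ⟨s', rfl⟩) hl
      have := norm_inv_mul_le h2 (h2'.trans (List.append_assoc _ _ _))
      simp only [List.length_append] at *
      omega
    · obtain ⟨r, rfl⟩ := List.prefix_of_prefix_length_le (l₃ := p ++ s)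
        (h6 ▸ ⟨s', rfl⟩) ⟨s, rfl⟩ hl
      have := norm_inv_mul_le (h2.trans (List.append_assoc _ _ _)) h2'
      simp only [List.length_append] at *
      omega
  refine ⟨key, ?_⟩
  rintro c hca hcb
  by_contra! hc
  have hgc : g.toWord <+: c := by
    rcases key with h1 | h1
    · exact List.prefix_of_prefix_length_le h1 hca hc.le
    · exact List.prefix_of_prefix_length_le h1 hcb hc.le
  obtain ⟨r, rfl⟩ := hgc
  obtain ⟨s, hs⟩ := hca
  obtain ⟨t, ht⟩ := hcb
  have h1 := norm_inv_mul_le hs.symm ht.symm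
  have hs2 := norm_inv_mul_eq (a := g) (b := a) (p := g.toWord) (s := []) (t := r ++ s) (by simp)
    (by rw [← hs]; simp) (by simp)
  have ht2 := norm_inv_mul_eq (a := g) (b := b) (p := g.toWord) (s := []) (t := r ++ t) (by simp)
    (by rw [← ht]; simp) (by simp)
  have h5 : (a⁻¹ * g).norm = (g⁻¹ * a).norm := by
    rw [← FreeGroup.norm_inv_eq]; congr 1; group
  simp only [List.length_append, List.length_nil, FreeGroup.norm] at *
  omega

/-- An injective endomorphism maps the vertices along a ray to a sequence converging to an end. -/
theorem exists_tendsToEnd {k : ℕ} (f : FreeGroup (Fin k) →* FreeGroup (Fin k))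
    (hf : Function.Injective f) (x : Boundary k) :
    ∃ y, TendsToEnd (fun n => f (x.vertex n)) y := by
  set u : ℕ → FreeGroup (Fin k) := fun n => f (x.vertex n) with hu
  obtain ⟨C, hC⟩ : ∃ C, ∀ a : Fin k × Bool, (f (FreeGroup.mk [a])).norm ≤ C := by
    refine ⟨∑ a : Fin k × Bool, (f (FreeGroup.mk [a])).norm, fun a => ?_⟩
    exact Finset.single_le_sum (f := fun a : Fin k × Bool => (f (FreeGroup.mk [a])).norm)
      (fun _ _ => Nat.zero_le _) (Finset.mem_univ a)
  have hstep : ∀ n, ((u n)⁻¹ * u (n + 1)).norm ≤ C := by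
    intro n
    have : (u n)⁻¹ * u (n + 1) = f (FreeGroup.mk [x.1 n]) := by
      rw [hu]
      simp only [← map_inv, ← map_mul]
      congr 1
      rw [inv_mul_eq_iff_eq_mul, Boundary.vertex, Boundary.vertex, FreeGroup.mul_mk]
      congr 1
      simp [Boundary.pre, List.range_succ]
    rw [this]; exact hC _
  have huinj : Function.Injective u := by
    intro m n h
    have := congrArg FreeGroup.norm (hf h)
    simpa [Boundary.norm_vertex] using this
  have hfin : ∀ R : ℕ, {g : FreeGroup (Fin k) | g.norm ≤ R}.Finite := by
    intro R
    refine Set.Finite.of_finite_image (f := FreeGroup.toWord) ?_ FreeGroup.toWord_injective.injOn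
    refine (List.finite_length_le (Fin k × Bool) R).subset ?_
    rintro _ ⟨g, hg, rfl⟩
    exact hg
  have hlarge : ∀ R : ℕ, ∃ n₀, ∀ n ≥ n₀, R ≤ (u n).norm := by
    intro R
    have h1 : {n | (u n).norm ≤ R}.Finite := (hfin R).preimage huinj.injOn
    obtain ⟨b, hb⟩ := h1.bddAbove
    refine ⟨b + 1, fun n hn => ?_⟩
    by_contra! h
    have := hb (show n ∈ {n | (u n).norm ≤ R} from h.le)
    omega
  choose n₀ hn₀ using hlarge
  -- the first `m` letters of `u n` do not depend on `n ≥ n₀ (m + C)`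
  have hconst : ∀ m, ∀ n ≥ n₀ (m + C), (u n).toWord.take m = (u (n₀ (m + C))).toWord.take m := by
    intro m n hn
    induction n, hn using Nat.le_induction with
    | base => rfl
    | succ n hn ih => rw [← ih, take_eq_of_norm_le (hstep n) (hn₀ _ n hn)]
  let w : ℕ → List (Fin k × Bool) := fun m => (u (n₀ (m + C))).toWord.take m
  have hwl : ∀ m, (w m).length = m := by
    intro m
    have := hn₀ (m + C) _ le_rfl
    rw [FreeGroup.norm] at this
    simp only [w, List.length_take]
    omega
  have hwr : ∀ m, FreeGroup.IsReduced (w m) := fun m =>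
    (FreeGroup.isReduced_toWord (x := u (n₀ (m + C)))).infix (List.take_prefix _ _).isInfix
  have hwt : ∀ m n, m ≤ n → (w n).take m = w m := by
    intro m n hmn
    have h1 := hconst m (max (n₀ (m + C)) (n₀ (n + C))) (le_max_left _ _)
    have h2 := hconst n (max (n₀ (m + C)) (n₀ (n + C))) (le_max_right _ _)
    simp only [w]
    rw [← h1, ← h2, List.take_take, min_eq_left hmn]
  have hget : ∀ m n (h : m < n), (w n)[m]'(by rw [hwl]; exact h) =
      (w (m + 1))[m]'(by rw [hwl]; omega) := by
    intro m n h
    simp only [← hwt (m + 1) n h, List.getElem_take]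
  let y : Boundary k := ⟨fun m => (w (m + 1))[m]'(by rw [hwl]; omega), by
    intro m
    have h1 := List.isChain_iff_getElem.1 (hwr (m + 2)) m (by rw [hwl]; omega)
    rw [hget m (m + 2) (by omega)] at h1
    exact h1⟩
  have hy : ∀ m, y.pre m = w m := by
    intro m
    apply List.ext_getElem
    · rw [y.pre_length, hwl]
    · intro i h1 h2
      rw [hwl] at h2
      rw [hget i m h2]
      simp [Boundary.pre, y]
  refine ⟨y, fun m => ?_⟩
  filter_upwards [eventually_ge_atTop (n₀ (m + C))] with n hn
  rw [hy]
  simp only [w]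
  rw [← hconst m n hn]
  exact List.take_prefix _ _

/-- The extension of an automorphism to the boundary: `x` is mapped to the limit of the images of
the vertices along `x`. -/
def boundaryMap {k : ℕ} (Φ : MulAut (FreeGroup (Fin k))) (x : Boundary k) : Boundary k :=
  (exists_tendsToEnd Φ.toMonoidHom Φ.injective x).choose

lemma boundaryMap_spec {k : ℕ} (Φ : MulAut (FreeGroup (Fin k))) (x : Boundary k) :
    TendsToEnd (fun n => Φ (x.vertex n)) (boundaryMap Φ x) :=
  (exists_tendsToEnd Φ.toMonoidHom Φ.injective x).choose_spec

/-- Limits at infinity are unique. -/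
lemma TendsToEnd.unique {k : ℕ} {u : ℕ → FreeGroup (Fin k)} {x y : Boundary k}
    (hx : TendsToEnd u x) (hy : TendsToEnd u y) : x = y := by
  ext n : 2
  obtain ⟨m, h1, h2⟩ := ((hx (n + 1)).and (hy (n + 1))).exists
  have h3 : x.pre (n + 1) = y.pre (n + 1) :=
    (List.prefix_of_prefix_length_le h1 h2 (by simp [Boundary.pre_length])).eq_of_length
      (by simp [Boundary.pre_length])
  simp only [Boundary.pre, List.map_inj_left, List.mem_range] at h3
  exact h3 n (by omega)

/-- `γ` is an oriented bi-infinite geodesic of the Cayley graph going from the end `x` to the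
end `y`: an isometric embedding of the integers for the word metric with these limits. -/
structure IsGeodesic {k : ℕ} (γ : ℤ → FreeGroup (Fin k)) (x y : Boundary k) : Prop where
  dist_eq : ∀ i j : ℤ, ((γ i)⁻¹ * γ j).norm = (i - j).natAbs
  tendsTo_left : TendsToEnd (fun n : ℕ => γ (-n)) x
  tendsTo_right : TendsToEnd (fun n : ℕ => γ n) y

/-- The geodesic from `x` to `y` passes through `g` and then through `h` (`g = h` allowed). -/
def PassesThrough {k : ℕ} (x y : Boundary k) (g h : FreeGroup (Fin k)) : Prop :=
  ∃ γ, IsGeodesic γ x y ∧ ∃ i j : ℤ, i ≤ j ∧ γ i = g ∧ γ j = h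

/-- The length of the longest common initial segment of two distinct rays. -/
def branch {k : ℕ} (x y : Boundary k) : ℕ := sInf {n | x.1 n ≠ y.1 n}

lemma branch_spec {k : ℕ} {x y : Boundary k} (h : x ≠ y) :
    x.1 (branch x y) ≠ y.1 (branch x y) := by
  have : {n | x.1 n ≠ y.1 n}.Nonempty := by
    by_contra h1
    apply h
    ext n : 2
    by_contra h2
    exact h1 ⟨n, h2⟩
  exact Nat.sInf_mem this

lemma eq_of_lt_branch {k : ℕ} {x y : Boundary k} {n : ℕ} (h : n < branch x y) :
    x.1 n = y.1 n := by
  by_contra h2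
  exact Nat.notMem_of_lt_sInf h h2

lemma branch_pre {k : ℕ} (x y : Boundary k) {n : ℕ} (h : n ≤ branch x y) :
    x.pre n = y.pre n := by
  simp only [Boundary.pre, List.map_inj_left, List.mem_range]
  exact fun i hi => eq_of_lt_branch (hi.trans_le h)

lemma le_branch {k : ℕ} {x y : Boundary k} (hxy : x ≠ y) {n : ℕ} (h : x.pre n = y.pre n) :
    n ≤ branch x y := by
  by_contra! h2
  simp only [Boundary.pre, List.map_inj_left, List.mem_range] at h
  exact branch_spec hxy (h _ h2)

lemma branch_comm {k : ℕ} (x y : Boundary k) : branch x y = branch y x := by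
  simp only [branch, ne_comm]

/-- The vertices of the geodesic line from `x` to `y`, when these ends are distinct. -/
def line {k : ℕ} (x y : Boundary k) (i : ℤ) : FreeGroup (Fin k) :=
  if 0 ≤ i then y.vertex (branch x y + i.toNat) else x.vertex (branch x y + (-i).toNat)

lemma line_of_nonneg {k : ℕ} (x y : Boundary k) (n : ℕ) :
    line x y n = y.vertex (branch x y + n) := by simp [line]

lemma line_neg {k : ℕ} (x y : Boundary k) (n : ℕ) :
    line x y (-n) = x.vertex (branch x y + n) := by
  rcases Nat.eq_zero_or_pos n with rfl | h
  · simp [line, Boundary.vertex, branch_pre x y le_rfl]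
  · rw [line, if_neg (by omega)]; simp

lemma norm_line {k : ℕ} (x y : Boundary k) (i : ℤ) :
    (line x y i).norm = branch x y + i.natAbs := by
  rw [line]
  split_ifs with h
  · rw [Boundary.norm_vertex]; omega
  · rw [Boundary.norm_vertex]; omega

lemma dist_vertex {k : ℕ} (x : Boundary k) {a : FreeGroup (Fin k)} {m : ℕ}
    (h : x.pre m <+: a.toWord) : (a⁻¹ * x.vertex m).norm + m = a.norm := by
  obtain ⟨t, ht⟩ := h
  rw [norm_inv_mul_eq (p := x.pre m) (s := t) (t := []) ht.symm (by simp [x.toWord_vertex])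
    (by simp), FreeGroup.norm, ← ht]
  simp [x.pre_length]; omega

lemma dist_line {k : ℕ} {x y : Boundary k} (hxy : x ≠ y) {a : FreeGroup (Fin k)} {M : ℕ}
    (hM : branch x y < M) (ha : x.pre M <+: a.toWord) {s : ℤ} (hs : branch x y - M ≤ s) :
    ((a⁻¹ * line x y s).norm : ℤ) = a.norm - branch x y + s := by
  rcases le_total s 0 with h0 | h0
  · obtain ⟨n, rfl⟩ : ∃ n : ℕ, s = -n := ⟨(-s).toNat, by omega⟩
    rw [line_neg]
    have := dist_vertex x ((x.pre_prefix (m := branch x y + n) (by omega)).trans ha)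
    omega
  · obtain ⟨n, rfl⟩ : ∃ n : ℕ, s = n := ⟨s.toNat, by omega⟩
    rw [line_of_nonneg]
    rcases Nat.eq_zero_or_pos n with rfl | hn
    · have := dist_vertex x ((x.pre_prefix (m := branch x y) hM.le).trans ha)
      rw [Boundary.vertex, branch_pre x y le_rfl] at this
      simp only [Boundary.vertex, add_zero, Nat.cast_zero]
      omega
    obtain ⟨t, ht⟩ := (x.pre_prefix (m := branch x y + 1) (by omega)).trans ha
    have e1 : a.toWord = x.pre (branch x y) ++ (x.1 (branch x y) :: t) := by
      rw [← ht]; simp [Boundary.pre, List.range_succ]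
    obtain ⟨t', ht'⟩ := y.pre_prefix (m := branch x y + 1) (n := branch x y + n) (by omega)
    have e2 : (y.vertex (branch x y + n)).toWord =
        x.pre (branch x y) ++ (y.1 (branch x y) :: t') := by
      rw [y.toWord_vertex, ← ht', branch_pre x y le_rfl]; simp [Boundary.pre, List.range_succ]
    rw [norm_inv_mul_eq e1 e2 (by simpa using branch_spec hxy)]
    have l1 := congrArg List.length e1
    have l2 := congrArg List.length e2
    rw [y.toWord_vertex] at l2
    simp only [List.length_append, Boundary.pre_length, List.length_cons] at l1 l2
    simp only [FreeGroup.norm, List.length_cons]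
    omega

lemma isGeodesic_line {k : ℕ} {x y : Boundary k} (hxy : x ≠ y) : IsGeodesic (line x y) x y := by
  refine ⟨?_, ?_, ?_⟩
  · have key : ∀ i j : ℤ, i ≤ j → ((line x y i)⁻¹ * line x y j).norm = (i - j).natAbs := by
      intro i j hij
      rcases lt_or_ge i 0 with h | h
      · obtain ⟨n, rfl⟩ : ∃ n : ℕ, i = -n := ⟨(-i).toNat, by omega⟩
        have h1 := dist_line hxy (a := line x y (-n)) (M := branch x y + n) (s := j) (by omega)
          (by rw [line_neg, x.toWord_vertex]) (by omega)
        rw [norm_line] at h1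
        omega
      · obtain ⟨n, rfl⟩ : ∃ n : ℕ, i = n := ⟨i.toNat, by omega⟩
        obtain ⟨m, rfl⟩ : ∃ m : ℕ, j = m := ⟨j.toNat, by omega⟩
        rw [line_of_nonneg, line_of_nonneg, ← FreeGroup.norm_inv_eq, mul_inv_rev, inv_inv]
        have := dist_vertex y (a := y.vertex (branch x y + m)) (m := branch x y + n)
          (by rw [y.toWord_vertex]; exact y.pre_prefix (by omega))
        rw [y.norm_vertex] at this
        omega
    intro i j
    rcases le_total i j with h | h
    · exact key i j h
    · rw [← FreeGroup.norm_inv_eq, mul_inv_rev, inv_inv, key j i h]; omega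
  · intro m
    filter_upwards [eventually_ge_atTop m] with n hn
    rw [line_neg, x.toWord_vertex]
    exact x.pre_prefix (by omega)
  · intro m
    filter_upwards [eventually_ge_atTop m] with n hn
    rw [line_of_nonneg, y.toWord_vertex]
    exact y.pre_prefix (by omega)

theorem passesThrough_iff {k : ℕ} {x y : Boundary k} (hxy : x ≠ y) (g h : FreeGroup (Fin k)) :
    PassesThrough x y g h ↔ ∃ s t : ℤ, s ≤ t ∧ line x y s = g ∧ line x y t = h := by
  refine ⟨?_, fun ⟨s, t, hst, h1, h2⟩ => ⟨line x y, isGeodesic_line hxy, s, t, hst, h1, h2⟩⟩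
  rintro ⟨γ, hγ, i, j, hij, rfl, rfl⟩
  have on : ∀ i : ℤ, ∃ s : ℤ, line x y s = γ i := by
    intro i
    set M := branch x y + (γ i).norm + 1 with hM
    obtain ⟨n, h1, h2, h3⟩ := ((hγ.tendsTo_left M).and ((hγ.tendsTo_right M).and
      (eventually_ge_atTop i.natAbs))).exists
    have ht := tight (a := γ (-n)) (g := γ i) (b := γ n) (by
      simp only [hγ.dist_eq]; omega)
    have hN : branch x y ≤ (γ i).norm := by
      have := ht.2 (x.pre (branch x y)) ((x.pre_prefix (by omega)).trans h1)
        (by rw [branch_pre x y le_rfl]; exact (y.pre_prefix (by omega)).trans h2)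
      rwa [x.pre_length] at this
    have aux : ∀ z : Boundary k, ∀ b : FreeGroup (Fin k), z.pre M <+: b.toWord →
        (γ i).toWord <+: b.toWord → γ i = z.vertex (γ i).norm := by
      intro z b h5 h6
      have h7 := z.eq_pre (List.prefix_of_prefix_length_le h6 h5
        (by rw [z.pre_length]; change (γ i).norm ≤ _; omega))
      rw [← FreeGroup.toWord_inj, z.toWord_vertex]
      exact h7
    rcases ht.1 with h4 | h4
    · refine ⟨-(((γ i).norm - branch x y : ℕ) : ℤ), ?_⟩
      rw [line_neg, Nat.add_sub_cancel' hN]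
      exact (aux x _ h1 h4).symm
    · refine ⟨(((γ i).norm - branch x y : ℕ) : ℤ), ?_⟩
      rw [line_of_nonneg, Nat.add_sub_cancel' hN]
      exact (aux y _ h2 h4).symm
  obtain ⟨s, hs⟩ := on i
  obtain ⟨t, ht⟩ := on j
  refine ⟨s, t, ?_, hs, ht⟩
  set M := branch x y + s.natAbs + t.natAbs + 1 with hM
  obtain ⟨n, h1, h3⟩ := ((hγ.tendsTo_left M).and
      (eventually_ge_atTop (i.natAbs + j.natAbs))).exists
  have e1 := dist_line hxy (M := M) (by omega) h1 (s := s) (by omega)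
  have e2 := dist_line hxy (M := M) (by omega) h1 (s := t) (by omega)
  rw [hs, hγ.dist_eq] at e1
  rw [ht, hγ.dist_eq] at e2
  omega

/-- A geodesic passes through the identity exactly when its ends have distinct first letters. -/
lemma passesThrough_one_iff {k : ℕ} {x y : Boundary k} (hxy : x ≠ y) :
    PassesThrough x y 1 1 ↔ x.1 0 ≠ y.1 0 := by
  rw [passesThrough_iff hxy]
  constructor
  · rintro ⟨s, t, hst, h1, h2⟩
    have := norm_line x y s
    rw [h1, FreeGroup.norm_one] at this
    have h0 : branch x y = 0 := by omega
    have := branch_spec hxy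
    rwa [h0] at this
  · intro h
    have h0 : branch x y = 0 := by
      by_contra h1
      exact h (eq_of_lt_branch (by omega))
    refine ⟨0, 0, le_rfl, ?_⟩
    rw [and_self]
    rw [← FreeGroup.norm_eq_zero, norm_line, h0]; rfl

lemma eq_vertex_iff {k : ℕ} (x : Boundary k) (g : FreeGroup (Fin k)) :
    g = x.vertex g.norm ↔ x.pre g.norm = g.toWord := by
  rw [← FreeGroup.toWord_inj, x.toWord_vertex, eq_comm]

lemma line_eq_iff {k : ℕ} {x y : Boundary k} (g : FreeGroup (Fin k)) (s : ℤ) :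
    line x y s = g ↔ (s = (g.norm : ℤ) - branch x y ∧ branch x y ≤ g.norm ∧
      y.pre g.norm = g.toWord) ∨ 
      (s = (branch x y : ℤ) - g.norm ∧ branch x y ≤ g.norm ∧ x.pre g.norm = g.toWord) := by
  constructor
  · intro h
    have hn := norm_line x y s
    rw [h] at hn
    rcases le_total s 0 with h0 | h0
    · obtain ⟨n, rfl⟩ : ∃ n : ℕ, s = -n := ⟨(-s).toNat, by omega⟩
      right
      refine ⟨by omega, by omega, ?_⟩
      rw [line_neg] at h
      rw [← eq_vertex_iff, hn, ← h]
      simp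
    · obtain ⟨n, rfl⟩ : ∃ n : ℕ, s = n := ⟨s.toNat, by omega⟩
      left
      refine ⟨by omega, by omega, ?_⟩
      rw [line_of_nonneg] at h
      rw [← eq_vertex_iff, hn, ← h]
      simp
  · rintro (⟨h1, h2, h3⟩ | ⟨h1, h2, h3⟩)
    · rw [← eq_vertex_iff] at h3
      obtain ⟨n, hn⟩ := Nat.exists_eq_add_of_le h2
      rw [show s = n by omega, line_of_nonneg, ← hn]
      exact h3.symm
    · rw [← eq_vertex_iff] at h3
      obtain ⟨n, hn⟩ := Nat.exists_eq_add_of_le h2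
      rw [show s = -n by omega, line_neg, ← hn]
      exact h3.symm

lemma passesThrough_iff_of_prefix {k : ℕ} {x y : Boundary k} (hxy : x ≠ y)
    {g h : FreeGroup (Fin k)} (hgh : g ≠ h) (hp : g.toWord <+: h.toWord) :
    PassesThrough x y g h ↔ branch x y ≤ g.norm ∧ y.pre h.norm = h.toWord := by
  have hl : g.norm < h.norm := by
    refine lt_of_le_of_ne hp.length_le fun e => hgh ?_
    rw [← FreeGroup.toWord_inj]
    exact hp.eq_of_length e
  have hsub : ∀ z : Boundary k, z.pre h.norm = h.toWord → z.pre g.norm = g.toWord := by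
    intro z hz
    rw [← hz] at hp
    exact (z.eq_pre hp).symm
  rw [passesThrough_iff hxy]
  simp only [line_eq_iff]
  constructor
  · rintro ⟨s, t, hst, ⟨h1, h2, h3⟩ | ⟨h1, h2, h3⟩, ⟨h4, h5, h6⟩ | ⟨h4, h5, h6⟩⟩
    · exact ⟨h2, h6⟩
    · omega
    · exact ⟨h2, h6⟩
    · omega
  · rintro ⟨h1, h2⟩
    exact ⟨_, _, by omega, Or.inl ⟨rfl, h1, hsub y h2⟩, Or.inl ⟨rfl, by omega, h2⟩⟩

lemma passesThrough_swap {k : ℕ} {x y : Boundary k} (hxy : x ≠ y) (g h : FreeGroup (Fin k)) :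
    PassesThrough x y g h ↔ PassesThrough y x h g := by
  rw [passesThrough_iff hxy, passesThrough_iff hxy.symm]
  have hl : ∀ s, line y x s = line x y (-s) := by
    intro s
    rcases le_total s 0 with h0 | h0
    · obtain ⟨n, rfl⟩ : ∃ n : ℕ, s = -n := ⟨(-s).toNat, by omega⟩
      rw [line_neg, neg_neg, line_of_nonneg, branch_comm]
    · obtain ⟨n, rfl⟩ : ∃ n : ℕ, s = n := ⟨s.toNat, by omega⟩
      rw [line_neg, line_of_nonneg, branch_comm]
  constructor
  · rintro ⟨s, t, hst, h1, h2⟩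
    exact ⟨-t, -s, by omega, by rw [hl, neg_neg, h2], by rw [hl, neg_neg, h1]⟩
  · rintro ⟨s, t, hst, h1, h2⟩
    exact ⟨-t, -s, by omega, by rw [← hl, h2], by rw [← hl, h1]⟩

lemma passesThrough_iff_of_not_prefix {k : ℕ} {x y : Boundary k} (hxy : x ≠ y)
    {g h : FreeGroup (Fin k)} (h1 : ¬ g.toWord <+: h.toWord) (h2 : ¬ h.toWord <+: g.toWord) :
    PassesThrough x y g h ↔ x.pre g.norm = g.toWord ∧ y.pre h.norm = h.toWord := by
  have hno : ∀ z : Boundary k, z.pre g.norm = g.toWord → z.pre h.norm = h.toWord → False := by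
    intro z hz hz'
    rw [← hz, ← hz'] at h1 h2
    rcases le_total g.norm h.norm with h | h
    · exact h1 (z.pre_prefix h)
    · exact h2 (z.pre_prefix h)
  rw [passesThrough_iff hxy]
  simp only [line_eq_iff]
  constructor
  · rintro ⟨s, t, hst, ⟨h1, h2, h3⟩ | ⟨h1, h2, h3⟩, ⟨h4, h5, h6⟩ | ⟨h4, h5, h6⟩⟩
    · exact (hno _ h3 h6).elim
    · have hg : g.norm = branch x y := by omega
      rw [hg, ← branch_pre x y le_rfl, ← hg] at h3
      exact (hno _ h3 h6).elim
    · exact ⟨h3, h6⟩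
    · exact (hno _ h3 h6).elim
  · rintro ⟨h3, h4⟩
    have a1 : branch x y ≤ g.norm := by
      by_contra! h
      rw [branch_pre x y h.le] at h3
      exact hno _ h3 h4
    have a2 : branch x y ≤ h.norm := by
      by_contra! h
      rw [← branch_pre x y h.le] at h4
      exact hno _ h3 h4
    exact ⟨_, _, by omega, Or.inr ⟨rfl, a1, h3⟩, Or.inl ⟨rfl, a2, h4⟩⟩


/-- Transition kernel of the non-backtracking random walk: the next letter is uniformly distributed
among the `2k - 1` letters that do not cancel the last one. -/
def stepKernel (k n : ℕ) :
    Kernel ((i : Finset.Iic n) → (fun _ : ℕ => Fin k × Bool) i) (Fin k × Bool) :=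
  Kernel.ofFunOfCountable fun h => uniformOn
    {b | (h ⟨n, Finset.mem_Iic.2 le_rfl⟩).1 = b.1 → (h ⟨n, Finset.mem_Iic.2 le_rfl⟩).2 = b.2}

instance (k n : ℕ) : IsMarkovKernel (stepKernel k n) where
  isProbabilityMeasure h :=
    isProbabilityMeasure_uniformOn (Set.toFinite _) ⟨h ⟨n, Finset.mem_Iic.2 le_rfl⟩, fun _ => rfl⟩

/-- Law of the uniformly random infinite freely reduced word, on the space of all words: the first
letter is uniform among the `2k` letters, and then the walk is non-backtracking. -/
def wordMeasure (k : ℕ) : Measure (ℕ → Fin k × Bool) :=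
  Kernel.trajMeasure (X := fun _ => Fin k × Bool) (uniformOn Set.univ) (stepKernel k)

/-- The uniform frequency measure on the boundary. Its values on cylinders are computed in
`uniformMeasure_pre`. -/
def uniformMeasure (k : ℕ) : Measure (Boundary k) := (wordMeasure k).comap Subtype.val

lemma uniformOn_step {k : ℕ} (a b : Fin k × Bool) :
    uniformOn {c : Fin k × Bool | a.1 = c.1 → a.2 = c.2} {b} =
      if a.1 = b.1 → a.2 = b.2 then ((2 * k - 1 : ℕ) : ℝ≥0∞)⁻¹ else 0 := by
  classical
  have h1 : {c : Fin k × Bool | a.1 = c.1 → a.2 = c.2} =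
      ((Finset.univ.erase (a.1, !a.2) : Finset (Fin k × Bool)) : Set (Fin k × Bool)) := by
    ext ⟨c, d⟩
    simp only [Set.mem_ofPred_eq, Finset.coe_erase, Finset.coe_univ, Set.mem_sdiff, Set.mem_univ,
      true_and, Set.mem_singleton_iff, Prod.mk.injEq, not_and]
    rw [eq_comm]
    refine imp_congr_right fun _ => ?_
    cases d <;> cases a.2 <;> simp
  rw [h1, ← Finset.coe_singleton, uniformOn_apply_finset, Finset.card_erase_of_mem (by simp)]
  have h2 : b ∈ {c : Fin k × Bool | a.1 = c.1 → a.2 = c.2} ↔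
    b ∈ (Finset.univ.erase (a.1, !a.2) : Finset (Fin k × Bool)) := by rw [h1]; simp
  simp only [Set.mem_ofPred_eq] at h2
  split_ifs with h3
  · rw [Finset.inter_singleton_of_mem (h2.1 h3)]
    simp [mul_comm]
  · rw [Finset.inter_singleton_of_notMem (fun h => h3 (h2.2 h))]
    simp

lemma wordMeasure_cylinder {k : ℕ} [NeZero k] (w : ℕ → Fin k × Bool) (n : ℕ) :
    wordMeasure k {x | ∀ i ≤ n, x i = w i} =
      if ∀ i < n, (w i).1 = (w (i + 1)).1 → (w i).2 = (w (i + 1)).2 then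
        ((2 * k * (2 * k - 1) ^ n : ℕ) : ℝ≥0∞)⁻¹ else 0 := by
  induction n with
  | zero =>
    have h1 : {x : ℕ → Fin k × Bool | ∀ i ≤ 0, x i = w i} = (fun x => x 0) ⁻¹' {w 0} := by
      ext x; simp
    have h2 : (wordMeasure k).map (fun x => x 0) = uniformOn Set.univ := by
      have e : (fun x : ℕ → Fin k × Bool => x 0) =
          (fun z : Finset.Iic 0 → Fin k × Bool => z ⟨0, Finset.mem_Iic.2 le_rfl⟩) ∘
            Preorder.frestrictLe (π := fun _ => Fin k × Bool) 0 := rfl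
      rw [e, ← Measure.map_map (by fun_prop) (by fun_prop), wordMeasure, Kernel.trajMeasure,
        Measure.map_comp _ _ (by fun_prop), Kernel.traj_map_frestrictLe, Kernel.partialTraj_self,
        Measure.id_comp, Measure.map_map (by fun_prop) (by fun_prop)]
      convert Measure.map_id
      rfl
    rw [h1, ← Measure.map_apply (measurable_pi_apply 0) (measurableSet_singleton _), h2,
      uniformOn_univ]
    simp [mul_comm]
  | succ n ih =>
    have h1 : {x : ℕ → Fin k × Bool | ∀ i ≤ n + 1, x i = w i} =
        (fun x => (Preorder.frestrictLe (π := fun _ => Fin k × Bool) n x, x (n + 1))) ⁻¹'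
          ({fun i : Finset.Iic n => w i.1} ×ˢ {w (n + 1)}) := by
      ext x
      simp only [Set.mem_ofPred_eq, Set.mem_preimage, Set.mem_prod, Set.mem_singleton_iff,
        funext_iff, Preorder.frestrictLe_apply, Subtype.forall, Finset.mem_Iic]
      exact ⟨fun h => ⟨fun i hi => h i (by omega), h _ le_rfl⟩, fun ⟨h, h'⟩ i hi => by
        rcases Nat.lt_or_ge n i with h3 | h3
        · obtain rfl : i = n + 1 := by omega
          exact h'
        · exact h i h3⟩
    have h0 : {x : ℕ → Fin k × Bool | ∀ i ≤ n, x i = w i} =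
        (Preorder.frestrictLe (π := fun _ => Fin k × Bool) n) ⁻¹' {fun i : Finset.Iic n => w i.1} := by
      ext x
      simp only [Set.mem_ofPred_eq, Set.mem_preimage, Set.mem_singleton_iff,
        funext_iff, Preorder.frestrictLe_apply, Subtype.forall, Finset.mem_Iic]
    rw [h0, ← Measure.map_apply (by fun_prop) (measurableSet_singleton _)] at ih
    rw [h1, ← Measure.map_apply (by fun_prop)
      ((measurableSet_singleton _).prod (measurableSet_singleton _)), wordMeasure,
      ← Kernel.map_frestrictLe_trajMeasure_compProd_eq_map_trajMeasure,
      Measure.compProd_apply_prod (measurableSet_singleton _) (measurableSet_singleton _),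
      lintegral_singleton, ← wordMeasure, ih]
    change uniformOn _ _ * _ = _
    rw [uniformOn_step]
    simp only [Nat.lt_succ_iff_lt_or_eq, or_imp, forall_and, forall_eq]
    split_ifs with h3 h4 h5 h6
    · rw [← ENNReal.mul_inv (Or.inr (ENNReal.natCast_ne_top _))
        (Or.inl (ENNReal.natCast_ne_top _)), ← Nat.cast_mul]
      congr 2
      ring
    all_goals simp_all

lemma comap_val {β : Type*} [MeasurableSpace β] {p : β → Prop} (hp : MeasurableSet {x | p x})
    (μ : Measure β) (s : Set {x // p x}) : μ.comap Subtype.val s = μ (Subtype.val '' s) :=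
  (MeasurableEmbedding.subtype_coe hp).comap_apply μ s

lemma measurableSet_ne (k : ℕ) :
    MeasurableSet {p : Boundary k × Boundary k | p.1 ≠ p.2} := by
  have : {p : Boundary k × Boundary k | p.1 ≠ p.2} =
      ⋃ n, (fun p => (p.1.1 n, p.2.1 n)) ⁻¹'
        {q : (Fin k × Bool) × (Fin k × Bool) | q.1 ≠ q.2} := by
    ext p
    simp [Subtype.ext_iff, funext_iff]
  rw [this]
  refine MeasurableSet.iUnion fun n => ?_
  refine Measurable.prodMk ?_ ?_ MeasurableSet.of_discrete
  · exact (measurable_pi_apply n).comp (measurable_subtype_coe.comp measurable_fst)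
  · exact (measurable_pi_apply n).comp (measurable_subtype_coe.comp measurable_snd)

lemma ae_reduced {k : ℕ} [NeZero k] :
    ∀ᵐ x ∂wordMeasure k, ∀ n, (x n).1 = (x (n + 1)).1 → (x n).2 = (x (n + 1)).2 := by
  rw [ae_all_iff]
  intro n
  rw [ae_iff]
  let ext : (Fin (n + 2) → Fin k × Bool) → ℕ → Fin k × Bool := fun w i => w (Fin.ofNat (n + 2) i)
  refine measure_mono_null (t := ⋃ w : {w : Fin (n + 2) → Fin k × Bool |
    ¬ ((ext w n).1 = (ext w (n + 1)).1 → (ext w n).2 = (ext w (n + 1)).2)},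
      {x | ∀ i ≤ n + 1, x i = ext w i}) ?_ ?_
  · intro x hx
    have h : ∀ i ≤ n + 1, x i = ext (fun j => x j) i := by
      intro i hi
      simp [ext, Nat.mod_eq_of_lt (show i < n + 2 by omega)]
    refine Set.mem_iUnion.2 ⟨⟨fun j => x j, ?_⟩, h⟩
    simp only [Set.mem_ofPred_eq]
    rwa [← h n (by omega), ← h (n + 1) le_rfl]
  · refine measure_iUnion_null fun ⟨w, hw⟩ => ?_
    rw [wordMeasure_cylinder, if_neg]
    exact fun h => hw (h n (by omega))

lemma measurableSet_reduced (k : ℕ) : MeasurableSet {x : ℕ → Fin k × Bool |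
    ∀ n, (x n).1 = (x (n + 1)).1 → (x n).2 = (x (n + 1)).2} := by
  rw [Set.ofPred_forall]
  refine MeasurableSet.iInter fun n => ?_
  have h : Measurable (fun x : ℕ → Fin k × Bool => (x n, x (n + 1))) := by fun_prop
  exact h (MeasurableSet.of_discrete
    (s := {q : (Fin k × Bool) × (Fin k × Bool) | q.1.1 = q.2.1 → q.1.2 = q.2.2}))

lemma uniformMeasure_univ {k : ℕ} [NeZero k] : uniformMeasure k Set.univ = 1 := by
  rw [uniformMeasure, comap_val (measurableSet_reduced k),
    Set.image_univ]
  have : IsProbabilityMeasure (wordMeasure k) := by unfold wordMeasure; infer_instance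
  rw [← measure_univ (μ := wordMeasure k)]
  exact measure_congr (eventuallyEq_univ.2 (by
    filter_upwards [ae_reduced] with x hx using ⟨⟨x, hx⟩, rfl⟩))

instance {k : ℕ} : IsFiniteMeasure (uniformMeasure k) := by
  rcases Nat.eq_zero_or_pos k with rfl | h
  · have : IsEmpty (Boundary 0) := ⟨fun x => (x.1 0).1.elim0⟩
    refine ⟨?_⟩
    rw [Set.univ_eq_empty_iff.2 this]; simp
  · have : NeZero k := ⟨h.ne'⟩
    exact ⟨by rw [uniformMeasure_univ]; exact ENNReal.one_lt_top⟩

/-- The rays with a given initial segment of length `n + 1` have mass `1 / (2k (2k - 1) ^ n)`. -/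
lemma uniformMeasure_pre {k n : ℕ} {L : List (Fin k × Bool)} (hL : FreeGroup.IsReduced L)
    (hn : L.length = n + 1) : uniformMeasure k {x | x.pre (n + 1) = L} =
      ((2 * k * (2 * k - 1) ^ n : ℕ) : ℝ≥0∞)⁻¹ := by
  have : NeZero k := ⟨by
    rintro rfl
    exact (L[0]'(by omega)).1.elim0⟩
  rw [uniformMeasure, comap_val (measurableSet_reduced k)]
  let w : ℕ → Fin k × Bool := fun i => L[i]?.getD default
  have hw : ∀ i (h : i < L.length), w i = L[i] := by
    intro i h
    simp [w, h]
  have h1 : (Subtype.val '' {x : Boundary k | x.pre (n + 1) = L} : Set (ℕ → Fin k × Bool)) =ᵐ[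
      wordMeasure k] {x | ∀ i ≤ n, x i = w i} := by
    filter_upwards [ae_reduced] with x hx
    apply propext
    have h2 : x ∈ (Subtype.val '' {x : Boundary k | x.pre (n + 1) = L} : Set _) ↔
        Boundary.pre (⟨x, hx⟩ : Boundary k) (n + 1) = L :=
      ⟨by rintro ⟨z, hz, rfl⟩; exact hz, fun h => ⟨⟨x, hx⟩, h, rfl⟩⟩
    refine h2.trans ?_
    rw [List.ext_getElem_iff]
    rw [and_iff_right (by rw [Boundary.pre_length, hn])]
    refine forall_congr' fun i => ⟨fun h hi => ?_, fun h hi1 hi2 => ?_⟩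
    · rw [hw i (by omega), ← h (by rw [Boundary.pre_length]; omega) (by omega)]
      simp [Boundary.pre]
    · rw [← hw i (by omega), ← h (by omega)]
      simp [Boundary.pre]
  rw [measure_congr h1, wordMeasure_cylinder, if_pos]
  intro i hi
  rw [hw i (by omega), hw (i + 1) (by omega)]
  exact List.isChain_iff_getElem.1 hL i (by omega)

lemma measurableSet_pre {k : ℕ} (n : ℕ) (L : List (Fin k × Bool)) :
    MeasurableSet {x : Boundary k | x.pre n = L} := by
  have : {x : Boundary k | x.pre n = L} = (fun x : Boundary k => fun i : Fin n => x.1 i) ⁻¹'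
      {z | List.ofFn z = L} := by
    ext x
    simp [Boundary.pre, List.ofFn_eq_map, ← List.map_coe_finRange_eq_range, Function.comp_def]
  rw [this]
  exact (measurable_pi_lambda _ fun i => (measurable_pi_apply _).comp measurable_subtype_coe)
    MeasurableSet.of_discrete

/-- Pairs of distinct ends, that is, oriented bi-infinite geodesics of the Cayley graph. -/
abbrev Boundary2 (k : ℕ) : Type := {p : Boundary k × Boundary k // p.1 ≠ p.2}

/-- The uniform current, as a density against the product of two copies of the uniform frequency
measure. It is characterized by its values on cylinders, which are computed in
`uniformCurrent_cylinder`. -/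
def uniformCurrent (k : ℕ) : Measure (Boundary2 k) :=
  (((uniformMeasure k).prod (uniformMeasure k)).comap Subtype.val).withDensity fun p =>
    (2 * k / (2 * k - 1)) * (2 * k - 1) ^ (2 * branch p.1.1 p.1.2)

lemma uniformCurrent_rect {k : ℕ} {D E : Set (Boundary k)} (hD : MeasurableSet D)
    (hE : MeasurableSet E) {j : ℕ} (h : ∀ x ∈ D, ∀ y ∈ E, x ≠ y ∧ branch x y = j) :
    uniformCurrent k {p | p.1.1 ∈ D ∧ p.1.2 ∈ E} =
      (2 * k / (2 * k - 1)) * (2 * k - 1) ^ (2 * j) *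
        (uniformMeasure k D * uniformMeasure k E) := by
  have hm : MeasurableSet {p : Boundary2 k | p.1.1 ∈ D ∧ p.1.2 ∈ E} :=
    measurable_subtype_coe (hD.prod hE)
  have hne : MeasurableSet {p : Boundary k × Boundary k | p.1 ≠ p.2} :=
    measurableSet_ne k
  rw [uniformCurrent, withDensity_apply _ hm, setLIntegral_congr_fun (g := fun _ =>
    (2 * k / (2 * k - 1) : ℝ≥0∞) * (2 * k - 1) ^ (2 * j)) hm
    (by intro p hp; simp only; rw [(h _ hp.1 _ hp.2).2]), setLIntegral_const,
    comap_val hne, ← Measure.prod_prod]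
  congr 2
  ext p
  constructor
  · rintro ⟨q, hq, rfl⟩; exact hq
  · intro hp
    exact ⟨⟨p, (h _ hp.1 _ hp.2).1⟩, hp, rfl⟩

lemma branch_eq {k : ℕ} {x y : Boundary k} {m : ℕ} (h : x.pre m = y.pre m)
    (h' : x.pre (m + 1) ≠ y.pre (m + 1)) : x ≠ y ∧ branch x y = m := by
  have hxy : x ≠ y := by rintro rfl; exact h' rfl
  refine ⟨hxy, le_antisymm ?_ (le_branch hxy h)⟩
  by_contra! h2
  exact h' (branch_pre x y h2)

/-- The oriented geodesics passing through the oriented segment from `g` to `h`. -/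
def cylinder {k : ℕ} (g h : FreeGroup (Fin k)) : Set (Boundary2 k) :=
  {p | PassesThrough p.1.1 p.1.2 g h}

lemma rank_cast (k : ℕ) : (2 * k - 1 : ℝ≥0∞) = ((2 * k - 1 : ℕ) : ℝ≥0∞) := by
  push_cast; rfl

/-- Recursive computation of the measure of the lines leaving a fixed ray early. -/
lemma uniformCurrent_shell {k : ℕ} (σ : Boundary2 k → Boundary2 k)
    (hσb : ∀ p, branch (σ p).1.1 (σ p).1.2 = branch p.1.1 p.1.2)
    (hσ : ∀ {D E : Set (Boundary k)}, MeasurableSet D → MeasurableSet E → ∀ {j : ℕ},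
      (∀ x ∈ D, ∀ y ∈ E, x ≠ y ∧ branch x y = j) →
      uniformCurrent k {p | (σ p).1.1 ∈ D ∧ (σ p).1.2 ∈ E} =
        (2 * k / (2 * k - 1)) * (2 * k - 1) ^ (2 * j) *
        (uniformMeasure k D * uniformMeasure k E))
    (hσm : Measurable σ)
    {L : List (Fin k × Bool)} (hL : FreeGroup.IsReduced L) {n : ℕ} (hn : n < L.length) :
    uniformCurrent k {p | branch p.1.1 p.1.2 ≤ n ∧ (σ p).1.2.pre L.length = L} =
      (2 * k - 1) ^ n * uniformMeasure k {x | x.pre L.length = L} := by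
  obtain ⟨l, rfl⟩ : ∃ l, k = l + 1 := Nat.exists_eq_add_one.2 (Nat.pos_of_ne_zero (by
    rintro rfl
    exact (L[0]'(by omega)).1.elim0))
  have hq : (2 * ((l + 1 : ℕ) : ℝ≥0∞) - 1) = ((2 * l + 1 : ℕ) : ℝ≥0∞) := by
    rw [rank_cast]; congr 1
  have hred : ∀ j, FreeGroup.IsReduced (L.take j) := fun j =>
    hL.infix (List.take_prefix _ _).isInfix
  set E : Set (Boundary (l + 1)) := {x | x.pre L.length = L} with hE
  have hEm : MeasurableSet E := measurableSet_pre _ _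
  let D : ℕ → Set (Boundary (l + 1)) := fun j =>
    {x | x.pre j = L.take j} \ {x | x.pre (j + 1) = L.take (j + 1)}
  have hDm : ∀ j, MeasurableSet (D j) := fun j =>
    (measurableSet_pre _ _).diff (measurableSet_pre _ _)
  have hyE : ∀ y ∈ E, ∀ j ≤ L.length, y.pre j = L.take j := by
    intro y hy j hj
    have hy' : y.pre L.length = L := hy
    have := y.pre_take hj
    rw [hy'] at this
    exact this.symm
  have hDE : ∀ j < L.length, ∀ x ∈ D j, ∀ y ∈ E, x ≠ y ∧ branch x y = j := by
    rintro j hj x ⟨hx1, hx2⟩ y hy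
    apply branch_eq
    · rw [hyE y hy j hj.le]; exact hx1
    · rw [hyE y hy (j + 1) hj]; exact hx2
  have hbr : ∀ j < L.length, ∀ p : Boundary2 (l + 1), (σ p).1.2 ∈ E →
      (branch p.1.1 p.1.2 = j ↔ (σ p).1.1 ∈ D j) := by
    intro j hj p hp
    rw [← hσb p]
    refine ⟨?_, fun h => (hDE j hj _ h _ hp).2⟩
    rintro rfl
    refine ⟨?_, ?_⟩
    · change Boundary.pre _ _ = _
      rw [← hyE _ hp _ hj.le, branch_pre _ _ le_rfl]
    · change ¬ (Boundary.pre _ _ = _)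
      rw [← hyE _ hp _ hj]
      intro h
      have := le_branch (σ p).2 h
      omega
  have hsub : ∀ j, ({x | x.pre (j + 1) = L.take (j + 1)} : Set (Boundary (l + 1))) ⊆
      {x | x.pre j = L.take j} := by
    intro j x hx
    have h1 := congrArg (List.take j) (show x.pre (j + 1) = L.take (j + 1) from hx)
    rw [x.pre_take (by omega), List.take_take, min_eq_left (by omega)] at h1
    exact h1
  have hadd : ∀ j, uniformMeasure (l + 1) (D j) + uniformMeasure (l + 1)
      {x | x.pre (j + 1) = L.take (j + 1)} = uniformMeasure (l + 1) {x | x.pre j = L.take j} := by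
    intro j
    rw [← measure_union Set.disjoint_sdiff_left (measurableSet_pre _ _),
      Set.sdiff_union_of_subset (hsub j)]
  have hsucc : ∀ j < L.length, uniformMeasure (l + 1)
      {x | x.pre (j + 1) = L.take (j + 1)} = ((2 * (l + 1) * (2 * l + 1) ^ j : ℕ) : ℝ≥0∞)⁻¹ := by
    intro j hj
    rw [uniformMeasure_pre (hred _) (by simp; omega)]
    congr 1
  have hD0 : uniformMeasure (l + 1) (D 0) = ((2 * l + 1 : ℕ) : ℝ≥0∞) / (2 * (l + 1) : ℕ) := by
    have h1 := hadd 0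
    rw [hsucc 0 (by omega)] at h1
    have h2 : ({x | x.pre 0 = L.take 0} : Set (Boundary (l + 1))) = Set.univ := by
      ext x; simp [Boundary.pre]
    rw [h2, uniformMeasure_univ] at h1
    refine (ENNReal.add_left_inj (a := ((2 * (l + 1) * (2 * l + 1) ^ 0 : ℕ) : ℝ≥0∞)⁻¹)
      (by simp)).1 (h1.trans ?_)
    rw [pow_zero, mul_one, ENNReal.div_eq_inv_mul, ← ENNReal.inv_mul_cancel (a := ((2 * (l + 1) : ℕ) : ℝ≥0∞))
      (by simp) (ENNReal.natCast_ne_top _)]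
    push_cast
    ring
  have hDs : ∀ j, j + 1 < L.length → uniformMeasure (l + 1) (D (j + 1)) =
      ((2 * l : ℕ) : ℝ≥0∞) / (2 * (l + 1) * (2 * l + 1) ^ (j + 1) : ℕ) := by
    intro j hj
    have h1 := hadd (j + 1)
    rw [hsucc (j + 1) (by omega), hsucc j (by omega)] at h1
    refine (ENNReal.add_left_inj (a := ((2 * (l + 1) * (2 * l + 1) ^ (j + 1) : ℕ) : ℝ≥0∞)⁻¹)
      (by simp)).1 (h1.trans ?_)
    rw [ENNReal.div_eq_inv_mul, eq_comm]
    calc _ = ((2 * (l + 1) * (2 * l + 1) ^ (j + 1) : ℕ) : ℝ≥0∞)⁻¹ * ((2 * l + 1 : ℕ) : ℝ≥0∞) := by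
          push_cast; ring
      _ = _ := by
          rw [pow_succ, ← mul_assoc, Nat.cast_mul _ (2 * l + 1), ENNReal.mul_inv (by simp) (by simp),
            mul_assoc, ENNReal.inv_mul_cancel (by simp) (ENNReal.natCast_ne_top _), mul_one]
  have hrect : ∀ j < L.length, uniformCurrent (l + 1) {p | (σ p).1.1 ∈ D j ∧ (σ p).1.2 ∈ E} =
      ((2 * (l + 1) : ℕ) : ℝ≥0∞) / (2 * l + 1 : ℕ) * (2 * l + 1 : ℕ) ^ (2 * j) *
        (uniformMeasure (l + 1) (D j) * uniformMeasure (l + 1) E) := by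
    intro j hj
    rw [hσ (hDm j) hEm (hDE j hj), hq]
    push_cast
    rfl
  rw [hq]
  clear hq
  generalize hQ : (2 * l + 1 : ℕ) = Q at *
  generalize hK : (2 * (l + 1) : ℕ) = K at *
  have hQ0 : (Q : ℝ≥0∞) ≠ 0 := by rw [← hQ]; simp
  have hK0 : (K : ℝ≥0∞) ≠ 0 := by rw [← hK]; simp
  have hQt : (Q : ℝ≥0∞) ≠ ⊤ := ENNReal.natCast_ne_top _
  have hKt : (K : ℝ≥0∞) ≠ ⊤ := ENNReal.natCast_ne_top _
  induction n with
  | zero =>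
    have : {p : Boundary2 (l + 1) | branch p.1.1 p.1.2 ≤ 0 ∧ (σ p).1.2.pre L.length = L} =
        {p | (σ p).1.1 ∈ D 0 ∧ (σ p).1.2 ∈ E} := by
      ext p
      simp only [Set.mem_ofPred_eq, Nat.le_zero]
      exact and_congr_left (hbr 0 hn p)
    rw [this, hrect 0 hn, hD0, mul_zero, pow_zero, mul_one, one_mul, ← mul_assoc]
    rw [show (K : ℝ≥0∞) / Q * (Q / K) = 1 from ?_, one_mul]
    rw [ENNReal.div_eq_inv_mul, ENNReal.div_eq_inv_mul, mul_comm (K : ℝ≥0∞)⁻¹,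
      mul_mul_mul_comm, ENNReal.inv_mul_cancel hQ0 hQt, ENNReal.mul_inv_cancel hK0 hKt, one_mul]
  | succ n ih =>
    have : {p : Boundary2 (l + 1) | branch p.1.1 p.1.2 ≤ n + 1 ∧ (σ p).1.2.pre L.length = L} =
        {p | branch p.1.1 p.1.2 ≤ n ∧ (σ p).1.2.pre L.length = L} ∪
        {p | (σ p).1.1 ∈ D (n + 1) ∧ (σ p).1.2 ∈ E} := by
      ext p
      simp only [Set.mem_ofPred_eq, Set.mem_union]
      rw [← and_congr_left (hbr (n + 1) hn p)]
      change _ ∧ (σ p).1.2 ∈ E ↔ (_ ∧ (σ p).1.2 ∈ E) ∨ _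
      rw [← or_and_right, Nat.le_succ_iff]
    rw [this, measure_union, ih (by omega), hrect (n + 1) hn, hDs n hn]
    · rw [← mul_assoc, ← add_mul]
      congr 1
      have e : (K : ℝ≥0∞) / Q * Q ^ (2 * (n + 1)) * (((2 * l : ℕ) : ℝ≥0∞) / ((K * Q ^ (n + 1) : ℕ) : ℝ≥0∞)) =
          Q ^ n * (2 * l : ℕ) := by
        rw [ENNReal.div_eq_inv_mul, ENNReal.div_eq_inv_mul, Nat.cast_mul,
          ENNReal.mul_inv (Or.inl hK0) (Or.inl hKt), Nat.cast_pow]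
        have : ((Q : ℝ≥0∞)⁻¹ * K * Q ^ (2 * (n + 1)) * ((K : ℝ≥0∞)⁻¹ * ((Q : ℝ≥0∞) ^ (n + 1))⁻¹ * (2 * l : ℕ)))
          = (K * (K : ℝ≥0∞)⁻¹) * ((Q : ℝ≥0∞) * (Q : ℝ≥0∞)⁻¹) * (Q ^ (n + 1) * ((Q : ℝ≥0∞) ^ (n + 1))⁻¹) *
            (Q ^ n * (2 * l : ℕ)) := by ring
        rw [this, ENNReal.mul_inv_cancel hK0 hKt, ENNReal.mul_inv_cancel hQ0 hQt,
          ENNReal.mul_inv_cancel (pow_ne_zero _ hQ0) (ENNReal.pow_ne_top hQt)]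
        simp
      rw [e, pow_succ, ← hQ]
      push_cast
      ring
    · rw [Set.disjoint_left]
      rintro p ⟨h1, h2⟩ ⟨h3, h4⟩
      have := (hbr (n + 1) hn p h4).2 h3
      omega
    · exact hσm (measurable_subtype_coe ((hDm _).prod hEm))

lemma measurable_swap (k : ℕ) :
    Measurable (fun p : Boundary2 k => (⟨p.1.swap, p.2.symm⟩ : Boundary2 k)) :=
  Measurable.subtype_mk (_root_.measurable_swap.comp measurable_subtype_coe)

/-- The defining property of the uniform current: the cylinder of the segment from `g` to `h` has
the mass that the uniform frequency measure gives to the rays starting with `g⁻¹ * h`. -/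
theorem uniformCurrent_cylinder {k : ℕ} {g h : FreeGroup (Fin k)} (hgh : g ≠ h) :
    uniformCurrent k (cylinder g h) =
      ((2 * k * (2 * k - 1) ^ ((g⁻¹ * h).norm - 1) : ℕ) : ℝ≥0∞)⁻¹ := by
  obtain ⟨l, rfl⟩ : ∃ l, k = l + 1 := Nat.exists_eq_add_one.2 (Nat.pos_of_ne_zero (by
    rintro rfl
    exact hgh (Subsingleton.elim _ _)))
  have hq : (2 * ((l + 1 : ℕ) : ℝ≥0∞) - 1) = ((2 * l + 1 : ℕ) : ℝ≥0∞) := by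
    rw [rank_cast]; congr 1
  have hq2 : 2 * (l + 1) - 1 = 2 * l + 1 := by omega
  have hQ0 : ((2 * l + 1 : ℕ) : ℝ≥0∞) ≠ 0 := by simp
  have hK0 : ((2 * (l + 1) : ℕ) : ℝ≥0∞) ≠ 0 := by simp
  have hQt : ((2 * l + 1 : ℕ) : ℝ≥0∞) ≠ ⊤ := ENNReal.natCast_ne_top _
  have hKt : ((2 * (l + 1) : ℕ) : ℝ≥0∞) ≠ ⊤ := ENNReal.natCast_ne_top _
  have fin : ∀ {u v : FreeGroup (Fin (l + 1))} {t : List (Fin (l + 1) × Bool)},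
      u.toWord ++ t = v.toWord → u ≠ v →
      (2 * ((l + 1 : ℕ) : ℝ≥0∞) - 1) ^ u.norm *
        uniformMeasure (l + 1) {x | x.pre v.toWord.length = v.toWord} =
      ((2 * (l + 1) * (2 * (l + 1) - 1) ^ (t.length - 1) : ℕ) : ℝ≥0∞)⁻¹ := by
    intro u v t ht huv
    have hl : u.norm + t.length = v.norm := by
      have := congrArg List.length ht
      simpa [FreeGroup.norm] using this
    have ht0 : 0 < t.length := by
      rcases t with _ | ⟨e, t⟩
      · exact (huv (FreeGroup.toWord_injective (by simpa using ht))).elim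
      · simp
    have := uniformMeasure_pre (n := u.norm + (t.length - 1))
      (FreeGroup.isReduced_toWord (x := v)) (by change v.norm = _; omega)
    change _ * uniformMeasure (l + 1) {x | x.pre v.norm = v.toWord} = _
    rw [show v.norm = u.norm + (t.length - 1) + 1 by omega, this, hq, hq2, pow_add, ← mul_assoc,
      mul_right_comm, Nat.cast_mul, Nat.cast_pow,
      ENNReal.mul_inv (Or.inr (ENNReal.pow_ne_top hQt)) (Or.inr (pow_ne_zero _ hQ0)), mul_comm,
      mul_assoc, ENNReal.inv_mul_cancel (pow_ne_zero _ hQ0) (ENNReal.pow_ne_top hQt), mul_one]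
  by_cases h1 : g.toWord <+: h.toWord
  · have : cylinder g h = {p | branch p.1.1 p.1.2 ≤ g.norm ∧
        (id p).1.2.pre h.toWord.length = h.toWord} := by
      ext p
      exact passesThrough_iff_of_prefix p.2 hgh h1
    obtain ⟨t, ht⟩ := h1
    have hlt : g.norm < h.toWord.length := by
      rcases t with _ | ⟨e, t⟩
      · exact (hgh (FreeGroup.toWord_injective (by simpa using ht))).elim
      · rw [← ht]; simp [FreeGroup.norm]
    rw [this, uniformCurrent_shell id (fun _ => rfl) (fun hD hE _ hj => uniformCurrent_rect hD hE hj)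
      measurable_id FreeGroup.isReduced_toWord hlt, fin ht hgh]
    rw [norm_inv_mul_eq (p := g.toWord) (s := []) (t := t) (by simp) ht.symm (by simp)]
    simp
  by_cases h2 : h.toWord <+: g.toWord
  · have : cylinder g h = {p | branch p.1.1 p.1.2 ≤ h.norm ∧
        ((fun p : Boundary2 (l + 1) => (⟨p.1.swap, p.2.symm⟩ : Boundary2 (l + 1))) p).1.2.pre
          g.toWord.length = g.toWord} := by
      ext p
      refine (passesThrough_swap p.2 g h).trans ?_
      refine (passesThrough_iff_of_prefix p.2.symm hgh.symm h2).trans ?_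
      rw [branch_comm]; rfl
    obtain ⟨t, ht⟩ := h2
    have hlt : h.norm < g.toWord.length := by
      rcases t with _ | ⟨e, t⟩
      · exact (hgh.symm (FreeGroup.toWord_injective (by simpa using ht))).elim
      · rw [← ht]; simp [FreeGroup.norm]
    rw [this, uniformCurrent_shell _ (fun _ => branch_comm _ _) ?_
      (measurable_swap _) FreeGroup.isReduced_toWord hlt, fin ht hgh.symm]
    · rw [norm_inv_mul_eq (p := h.toWord) (s := t) (t := []) ht.symm (by simp) (by simp)]
      simp
    · intro D E hD hE j hj
      rw [mul_comm (uniformMeasure _ D), ← uniformCurrent_rect hE hD (j := j)]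
      · congr 1
        ext p
        exact and_comm
      · intro x hx y hy
        rw [ne_comm, branch_comm]
        exact hj y hy x hx
  · have : cylinder g h = {p | p.1.1 ∈ {x : Boundary (l + 1) | x.pre g.norm = g.toWord} ∧
        p.1.2 ∈ {x : Boundary (l + 1) | x.pre h.norm = h.toWord}} := by
      ext p
      exact passesThrough_iff_of_not_prefix p.2 h1 h2
    obtain ⟨p, s, t, hs, ht, hst⟩ := exists_split g.toWord h.toWord
    have hsl : g.norm = p.length + s.length := by rw [FreeGroup.norm, hs]; simp
    have htl : h.norm = p.length + t.length := by rw [FreeGroup.norm, ht]; simp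
    have hs0 : 0 < s.length := by
      rcases s with _ | ⟨e, s⟩
      · exact (h1 ⟨t, by rw [hs, ht]; simp⟩).elim
      · simp
    have ht0 : 0 < t.length := by
      rcases t with _ | ⟨e, t⟩
      · exact (h2 ⟨s, by rw [hs, ht]; simp⟩).elim
      · simp
    rw [this, uniformCurrent_rect (measurableSet_pre _ _) (measurableSet_pre _ _)
      (j := p.length), norm_inv_mul_eq hs ht hst]
    · have m1 := uniformMeasure_pre (n := p.length + s.length - 1)
        (FreeGroup.isReduced_toWord (x := g)) (by change g.norm = _; omega)
      have m2 := uniformMeasure_pre (n := p.length + t.length - 1)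
        (FreeGroup.isReduced_toWord (x := h)) (by change h.norm = _; omega)
      rw [show g.norm = p.length + s.length - 1 + 1 by omega,
        show h.norm = p.length + t.length - 1 + 1 by omega, m1, m2, hq, hq2]
      obtain ⟨a, ha⟩ : ∃ a, s.length = a + 1 := Nat.exists_eq_add_one.2 hs0
      obtain ⟨b, hb⟩ : ∃ b, t.length = b + 1 := Nat.exists_eq_add_one.2 ht0
      rw [ha, hb, show p.length + (a + 1) - 1 = p.length + a by omega,
        show p.length + (b + 1) - 1 = p.length + b by omega,
        show a + 1 + (b + 1) - 1 = a + b + 1 by omega]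
      have hK : (2 * ((l + 1 : ℕ) : ℝ≥0∞)) = ((2 * (l + 1) : ℕ) : ℝ≥0∞) := by push_cast; rfl
      rw [hK]
      generalize (2 * l + 1 : ℕ) = Q at *
      generalize (2 * (l + 1) : ℕ) = K at *
      have i1 : ∀ n, ((K * Q ^ n : ℕ) : ℝ≥0∞)⁻¹ = (K : ℝ≥0∞)⁻¹ * ((Q : ℝ≥0∞)⁻¹) ^ n := by
        intro n
        rw [Nat.cast_mul, Nat.cast_pow, ENNReal.mul_inv (Or.inl hK0) (Or.inl hKt),
          ENNReal.inv_pow]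
      simp only [i1, ENNReal.div_eq_inv_mul]
      have : (Q : ℝ≥0∞)⁻¹ * K * Q ^ (2 * p.length) * ((K : ℝ≥0∞)⁻¹ * (Q : ℝ≥0∞)⁻¹ ^ (p.length + a) *
          ((K : ℝ≥0∞)⁻¹ * (Q : ℝ≥0∞)⁻¹ ^ (p.length + b))) = (K * (K : ℝ≥0∞)⁻¹) *
          (Q * (Q : ℝ≥0∞)⁻¹) ^ (2 * p.length) * ((K : ℝ≥0∞)⁻¹ * (Q : ℝ≥0∞)⁻¹ ^ (a + b + 1)) := by
        ring
      rw [this, ENNReal.mul_inv_cancel hK0 hKt, ENNReal.mul_inv_cancel hQ0 hQt]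
      simp
    · intro x hx y hy
      simp only [Set.mem_ofPred_eq] at hx hy
      have hxp : ∀ m ≤ g.norm, x.pre m = g.toWord.take m := by
        intro m hm
        rw [← hx, x.pre_take hm]
      have hyp : ∀ m ≤ h.norm, y.pre m = h.toWord.take m := by
        intro m hm
        rw [← hy, y.pre_take hm]
      apply branch_eq
      · rw [hxp _ (by omega), hyp _ (by omega), hs, ht]; simp
      · rw [hxp _ (by omega), hyp _ (by omega), hs, ht]
        rcases s with _ | ⟨e, s⟩
        · simp at hs0
        rcases t with _ | ⟨e', t⟩
        · simp at ht0
        intro he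
        simp [List.take_append] at he
        exact hst e (by simp) e' (by simp) he

/-- The base ball: the geodesics passing through the identity. -/
def baseBall (k : ℕ) : Set (Boundary2 k) := cylinder 1 1

/-- The length of an automorphism `Φ`: the length of the image of the uniform current, that is, the
mass that the uniform current gives to the preimage of the base ball under the action
`(x, y) ↦ (Φ x, Φ y)` on geodesics. -/
def autLength {k : ℕ} (Φ : MulAut (FreeGroup (Fin k))) : ℝ≥0∞ :=
  uniformCurrent k
    {p | (boundaryMap Φ p.1.1, boundaryMap Φ p.1.2) ∈ Subtype.val '' baseBall k}

/-- The outer automorphism group: automorphisms modulo inner automorphisms. -/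
abbrev Out (k : ℕ) : Type :=
  MulAut (FreeGroup (Fin k)) ⧸ (MulAut.conj : FreeGroup (Fin k) →* _).range

/-- The cyclically reduced length of an element. -/
def cyclicLength {k : ℕ} (w : FreeGroup (Fin k)) : ℕ :=
  (FreeGroup.reduceCyclically w.toWord).length

end

end FreeLength

namespace FreeLength

noncomputable section

/-! ### The boundary action -/

/-! A geodesic passes through 1 exactly when its ends have distinct first letters, so L(Φ) is the
mass of the pairs of ends whose Φ-images have distinct first letters (`autLength_eq`). The mass of a
cylinder depends only on g⁻¹h, so the current is invariant under left translation
(`measurePreserving_actPair`) and L depends only on the outer class. L(Φ) is finite by uniform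
continuity of Φ on the boundary.

Everything else rests on the finiteness of the set of outer classes with L < M
(`finite_autLength_lt`). In rank at most 1 the automorphism group is finite. In rank at least 2, let
ν be the uniform frequency measure. Each outer class has a representative Φ that is balanced: for
every letter a, the set C_a of rays x such that Φ(x) starts with a has ν-mass at most 1/2
(`exists_balanced`). For such a Φ the norm of t = Φ(s) is bounded by a constant times L(Φ), for
every letter s (`norm_letter_le`), and only finitely many automorphisms send the basis into a given
ball.

The bound on |t| comes from counting. Seen through Φ, the cone of t has mass at least δ =
1/(2(2k-1)), because translation by s distorts ν by a factor 2k-1 at most. If v is a proper prefix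
of t followed by the letter a, the cone of va contains the cone of t and lies in the cone of the
first letter of t, so its mass is between δ and 1/2. This cone corresponds to the translate of C_a
by Φ⁻¹(v). Hence the sets C_a together have |t| translates of intermediate mass.

Such translates are bounded in number (`card_mul_le_uniformCurrent`). If g⁻¹C has intermediate mass,
the geodesics crossing a given edge out of g with exactly one end in C have mass bounded below. In
the tree, a finite set G of vertices has at least |G| outward edges with no vertex of G beyond them,
and the geodesics entering along these edges form disjoint families. For C = C_a all these geodesics
are counted by L(Φ).

The statements on sequences follow by pigeonhole: if the lengths do not tend to infinity, one outer
class recurs, and on one outer class both the length and the cyclic length of the image of w are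
bounded. -/

lemma exists_norm_map_le {k : ℕ} (f : FreeGroup (Fin k) →* FreeGroup (Fin k)) :
    ∃ C, ∀ g, (f g).norm ≤ C * g.norm := by
  refine ⟨∑ a : Fin k × Bool, (f (FreeGroup.mk [a])).norm, fun g => ?_⟩
  set C := ∑ a : Fin k × Bool, (f (FreeGroup.mk [a])).norm
  have key : ∀ L : List (Fin k × Bool), (f (FreeGroup.mk L)).norm ≤ C * L.length := by
    intro L
    induction L with
    | nil => simp [← FreeGroup.one_eq_mk]
    | cons a L ih =>
      have h1 : FreeGroup.mk (a :: L) = FreeGroup.mk [a] * FreeGroup.mk L := by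
        rw [FreeGroup.mul_mk]; rfl
      have h2 : (f (FreeGroup.mk [a])).norm ≤ C :=
        Finset.single_le_sum (f := fun a : Fin k × Bool => (f (FreeGroup.mk [a])).norm)
          (fun _ _ => Nat.zero_le _) (Finset.mem_univ a)
      rw [h1, map_mul, List.length_cons, mul_add, mul_one]
      exact (FreeGroup.norm_mul_le _ _).trans (by omega)
  have := key g.toWord
  rwa [FreeGroup.mk_toWord] at this

lemma toWord_mk_of_prefix {k : ℕ} {h : FreeGroup (Fin k)} {L : List (Fin k × Bool)}
    (hL : L <+: h.toWord) : (FreeGroup.mk L).toWord = L := by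
  rw [FreeGroup.toWord_mk]
  exact (FreeGroup.isReduced_toWord.infix hL.isInfix).reduce_eq

/-- The first `m` letters of the image of a long element are not changed when it is extended. -/
lemma exists_take_map_eq {k : ℕ} (Φ : MulAut (FreeGroup (Fin k))) (m : ℕ) :
    ∃ R, ∀ g h : FreeGroup (Fin k), R ≤ g.norm → g.toWord <+: h.toWord →
      (Φ g).toWord.take m = (Φ h).toWord.take m := by
  obtain ⟨C, hC⟩ := exists_norm_map_le Φ.toMonoidHom
  obtain ⟨C', hC'⟩ := exists_norm_map_le Φ.symm.toMonoidHom
  -- The linear bound for the inverse shows that Φ sends long elements to long elements.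
  have hlarge : ∀ g : FreeGroup (Fin k), C' * (m + C) + 1 ≤ g.norm → m + C ≤ (Φ g).norm := by
    intro g hg
    by_contra! h
    have h1 : g.norm ≤ C' * (Φ g).norm := by simpa using hC' (Φ g)
    have h2 : C' * (Φ g).norm ≤ C' * (m + C) := Nat.mul_le_mul_left _ h.le
    omega
  refine ⟨C' * (m + C) + 1, fun g h hg => ?_⟩
  -- One letter of `h` is appended at a time: consecutive images are at distance at most `C` and
  -- have norm at least `m + C`, so cancellation never reaches the first `m` letters.
  have key : ∀ t : List (Fin k × Bool), g.toWord ++ t <+: h.toWord →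
      (Φ g).toWord.take m = (Φ (FreeGroup.mk (g.toWord ++ t))).toWord.take m := by
    intro t
    induction t using List.reverseRecOn with
    | nil => intro _; rw [List.append_nil, FreeGroup.mk_toWord]
    | append_singleton t a ih =>
      intro ht
      have ht' : g.toWord ++ t <+: h.toWord :=
        List.IsPrefix.trans ⟨[a], by simp⟩ ht
      rw [ih ht']
      have e : FreeGroup.mk (g.toWord ++ (t ++ [a])) =
          FreeGroup.mk (g.toWord ++ t) * FreeGroup.mk [a] := by
        rw [FreeGroup.mul_mk, List.append_assoc]
      refine take_eq_of_norm_le (C := C) ?_ (hlarge _ ?_)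
      · rw [e, map_mul, inv_mul_cancel_left]
        refine (hC (FreeGroup.mk [a])).trans ?_
        have : (FreeGroup.mk [a] : FreeGroup (Fin k)).norm ≤ 1 := FreeGroup.norm_mk_le
        exact (Nat.mul_le_mul_left _ this).trans (by simp)
      · rw [FreeGroup.norm, toWord_mk_of_prefix ht', List.length_append]
        rw [FreeGroup.norm] at hg
        omega
  rintro ⟨t, ht⟩
  rw [key t (by rw [ht]), ht, FreeGroup.mk_toWord]

/-- The first `m` letters of the image of a ray are those of the image of any group element that
shares a long initial segment with the ray. -/
lemma exists_pre_boundaryMap {k : ℕ} (Φ : MulAut (FreeGroup (Fin k))) (m : ℕ) :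
    ∃ R, ∀ (x : Boundary k) (g : FreeGroup (Fin k)), x.pre R <+: g.toWord →
      (boundaryMap Φ x).pre m = (Φ g).toWord.take m := by
  obtain ⟨R, hR⟩ := exists_take_map_eq Φ m
  refine ⟨R, fun x g hg => ?_⟩
  obtain ⟨n, h1, h2⟩ := ((boundaryMap_spec Φ x m).and (eventually_ge_atTop R)).exists
  rw [← hR (x.vertex R) g (by rw [x.norm_vertex]) (by rwa [x.toWord_vertex]),
    hR (x.vertex R) (x.vertex n) (by rw [x.norm_vertex])
      (by rw [x.toWord_vertex, x.toWord_vertex]; exact x.pre_prefix h2)]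
  have := List.prefix_iff_eq_take.1 h1
  rwa [Boundary.pre_length] at this

/-- Uniform continuity of the boundary map: two rays that agree on `R` letters can be compared with
the same group element, their common vertex at depth `R`. -/
lemma exists_pre_boundaryMap_congr {k : ℕ} (Φ : MulAut (FreeGroup (Fin k))) (m : ℕ) :
    ∃ R, ∀ x y : Boundary k, x.pre R = y.pre R →
      (boundaryMap Φ x).pre m = (boundaryMap Φ y).pre m := by
  obtain ⟨R, hR⟩ := exists_pre_boundaryMap Φ m
  refine ⟨R, fun x y h => ?_⟩
  rw [hR x (x.vertex R) (by rw [x.toWord_vertex]),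
    hR y (x.vertex R) (by rw [x.toWord_vertex, h])]

/-- Continuity along arbitrary sequences, not only along the vertices of the ray; together with
uniqueness of limits it makes the boundary action functorial. -/
lemma TendsToEnd.map {k : ℕ} {u : ℕ → FreeGroup (Fin k)} {x : Boundary k} (h : TendsToEnd u x)
    (Φ : MulAut (FreeGroup (Fin k))) : TendsToEnd (fun n => Φ (u n)) (boundaryMap Φ x) := by
  intro m
  obtain ⟨R, hR⟩ := exists_pre_boundaryMap Φ m
  filter_upwards [h R] with n hn
  rw [hR x _ hn]
  exact List.take_prefix _ _

lemma tendsToEnd_vertex {k : ℕ} (x : Boundary k) : TendsToEnd x.vertex x := by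
  intro m
  filter_upwards [eventually_ge_atTop m] with n hn
  rw [x.toWord_vertex]
  exact x.pre_prefix hn

lemma boundaryMap_mul {k : ℕ} (Φ Ψ : MulAut (FreeGroup (Fin k))) (x : Boundary k) :
    boundaryMap (Φ * Ψ) x = boundaryMap Φ (boundaryMap Ψ x) :=
  (boundaryMap_spec (Φ * Ψ) x).unique ((boundaryMap_spec Ψ x).map Φ)

lemma boundaryMap_one {k : ℕ} (x : Boundary k) : boundaryMap 1 x = x :=
  (boundaryMap_spec 1 x).unique (tendsToEnd_vertex x)

lemma boundaryMap_injective {k : ℕ} (Φ : MulAut (FreeGroup (Fin k))) :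
    Function.Injective (boundaryMap Φ) := by
  refine Function.LeftInverse.injective (g := boundaryMap Φ⁻¹) fun x => ?_
  rw [← boundaryMap_mul, inv_mul_cancel, boundaryMap_one]

/-- A perturbation of size `C` can alter only the last `C` letters, so the limit is unchanged. -/
lemma TendsToEnd.of_norm_le {k : ℕ} {u w : ℕ → FreeGroup (Fin k)} {x : Boundary k}
    (h : TendsToEnd u x) {C : ℕ} (hC : ∀ n, ((u n)⁻¹ * w n).norm ≤ C) : TendsToEnd w x := by
  intro m
  filter_upwards [h (m + C)] with n hn
  have h1 := hn.length_le
  rw [x.pre_length] at h1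
  have h2 := List.prefix_iff_eq_take.1 ((x.pre_prefix (Nat.le_add_right m C)).trans hn)
  rw [x.pre_length] at h2
  rw [h2, take_eq_of_norm_le (hC n) h1]
  exact List.take_prefix _ _

/-! ### Left translations of the boundary -/

/-- Left translation by a group element on the boundary. -/
def act {k : ℕ} (g : FreeGroup (Fin k)) (x : Boundary k) : Boundary k :=
  boundaryMap (MulAut.conj g) x

lemma TendsToEnd.act {k : ℕ} {u : ℕ → FreeGroup (Fin k)} {x : Boundary k} (h : TendsToEnd u x)
    (g : FreeGroup (Fin k)) : TendsToEnd (fun n => g * u n) (act g x) := by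
  -- The elements gug⁻¹ and gu differ by right multiplication by g, a bounded perturbation. For this
  -- reason the inner automorphism induces left translation on the boundary.
  refine (h.map (MulAut.conj g)).of_norm_le (C := g.norm) fun n => ?_
  rw [MulAut.conj_apply]
  exact le_of_eq (congrArg _ (by group))

lemma act_mul {k : ℕ} (g h : FreeGroup (Fin k)) (x : Boundary k) :
    act (g * h) x = act g (act h x) := by
  rw [act, map_mul, boundaryMap_mul]; rfl

lemma act_one {k : ℕ} (x : Boundary k) : act 1 x = x := by
  rw [act, map_one, boundaryMap_one]

lemma act_inv_act {k : ℕ} (g : FreeGroup (Fin k)) (x : Boundary k) : act g⁻¹ (act g x) = x := by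
  rw [← act_mul, inv_mul_cancel, act_one]

lemma act_act_inv {k : ℕ} (g : FreeGroup (Fin k)) (x : Boundary k) : act g (act g⁻¹ x) = x := by
  rw [← act_mul, mul_inv_cancel, act_one]

/-- Comes from the identity `Φ * conj g = conj (Φ g) * Φ`. It turns translates of a set defined by Φ
into sets defined by conjugates of Φ. -/
lemma boundaryMap_act {k : ℕ} (Φ : MulAut (FreeGroup (Fin k))) (g : FreeGroup (Fin k))
    (x : Boundary k) : boundaryMap Φ (act g x) = act (Φ g) (boundaryMap Φ x) := by
  rw [act, act, ← boundaryMap_mul, ← boundaryMap_mul]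
  congr 1
  ext h
  simp

lemma boundaryMap_conj_mul {k : ℕ} (g : FreeGroup (Fin k)) (Φ : MulAut (FreeGroup (Fin k)))
    (x : Boundary k) : boundaryMap (MulAut.conj g * Φ) x = act g (boundaryMap Φ x) :=
  boundaryMap_mul _ _ _

/-- Left translation prepends a word when there is no cancellation. -/
lemma pre_act {k : ℕ} {g : FreeGroup (Fin k)} {x : Boundary k}
    (h : FreeGroup.IsReduced (g.toWord ++ [x.1 0])) (n : ℕ) :
    (act g x).pre (g.norm + n) = g.toWord ++ x.pre n := by
  have hred : ∀ m, (g * x.vertex m).toWord = g.toWord ++ x.pre m := by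
    intro m
    have h1 : g * x.vertex m = FreeGroup.mk (g.toWord ++ x.pre m) := by
      rw [← FreeGroup.mul_mk, FreeGroup.mk_toWord]; rfl
    rw [h1, FreeGroup.toWord_mk]
    refine FreeGroup.IsReduced.reduce_eq ?_
    rcases m with _ | m
    · simp [Boundary.pre, FreeGroup.isReduced_toWord]
    have hx := x.isReduced_pre (m + 1)
    rw [FreeGroup.IsReduced, List.isChain_append] at h ⊢
    refine ⟨h.1, hx, fun u hu v hv => h.2.2 u hu v ?_⟩
    simpa [Boundary.pre, List.range_succ_eq_map] using hv
  obtain ⟨m, h1, h2⟩ := (((tendsToEnd_vertex x).act g (g.norm + n)).and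
    (eventually_ge_atTop n)).exists
  rw [hred m] at h1
  obtain ⟨t, ht⟩ := x.pre_prefix h2
  refine (List.prefix_of_prefix_length_le h1 (l₂ := g.toWord ++ x.pre n) ⟨t, ?_⟩ ?_).eq_of_length ?_
  · rw [List.append_assoc, ht]
  all_goals simp [Boundary.pre_length, FreeGroup.norm]

/-- The ray with the first `n` letters removed. -/
def Boundary.drop {k : ℕ} (x : Boundary k) (n : ℕ) : Boundary k :=
  ⟨fun i => x.1 (n + i), fun i => x.2 (n + i)⟩

lemma Boundary.pre_add {k : ℕ} (x : Boundary k) (n m : ℕ) :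
    x.pre (n + m) = x.pre n ++ (x.drop n).pre m := by
  simp [pre, List.range_add, drop]

lemma Boundary.ext_pre {k : ℕ} {x y : Boundary k} (h : ∀ n, x.pre n = y.pre n) : x = y := by
  ext n : 2
  have := h (n + 1)
  simp only [pre, List.map_inj_left, List.mem_range] at this
  exact this n (by omega)

lemma act_vertex_drop {k : ℕ} (x : Boundary k) (n : ℕ) : act (x.vertex n) (x.drop n) = x := by
  have h : FreeGroup.IsReduced ((x.vertex n).toWord ++ [(x.drop n).1 0]) := by
    have := x.isReduced_pre (n + 1)
    rw [x.pre_add] at this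
    simpa [x.toWord_vertex, Boundary.pre] using this
  have h2 := fun m => pre_act h m
  simp only [x.norm_vertex, x.toWord_vertex, ← x.pre_add] at h2
  refine Boundary.ext_pre fun m => ?_
  rw [← Boundary.pre_take _ (Nat.le_add_left m n), h2, Boundary.pre_take _ (Nat.le_add_left m n)]

lemma act_inv_of_pre {k : ℕ} {g : FreeGroup (Fin k)} {x : Boundary k}
    (h : x.pre g.norm = g.toWord) : act g⁻¹ x = x.drop g.norm := by
  conv_lhs => rw [← act_vertex_drop x g.norm, ← (eq_vertex_iff x g).2 h, act_inv_act]

/-! ### Invariance of the uniform current and finiteness of the length -/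

/-- A set determined by the first `R` letters is the union of the cylinders of depth `R` that meet
it, and there are countably many words. -/
lemma measurableSet_of_pre {k : ℕ} {S : Set (Boundary k)} (R : ℕ)
    (h : ∀ x y : Boundary k, x.pre R = y.pre R → x ∈ S → y ∈ S) : MeasurableSet S := by
  have : S = ⋃ L ∈ {L | ∃ x ∈ S, x.pre R = L}, {x | x.pre R = L} := by
    ext y
    simp only [Set.mem_iUnion, Set.mem_ofPred_eq, exists_prop]
    exact ⟨fun hy => ⟨_, ⟨y, hy, rfl⟩, rfl⟩, fun ⟨L, ⟨x, hx, h1⟩, h2⟩ => h x y (h1.trans h2.symm) hx⟩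
  rw [this]
  exact MeasurableSet.biUnion (Set.to_countable _) fun L _ => measurableSet_pre R L

lemma Boundary.apply_eq_of_pre {k : ℕ} {x y : Boundary k} {n m : ℕ} (h : x.pre n = y.pre n)
    (hm : m < n) : x.1 m = y.1 m := by
  simp only [pre, List.map_inj_left, List.mem_range] at h
  exact h m hm

lemma measurable_boundaryMap {k : ℕ} (Φ : MulAut (FreeGroup (Fin k))) :
    Measurable (boundaryMap Φ) := by
  refine Measurable.subtype_mk (f := fun x => (boundaryMap Φ x).1) ?_
  refine measurable_pi_lambda _ fun n => measurable_to_countable' fun a => ?_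
  obtain ⟨R, hR⟩ := exists_pre_boundaryMap_congr Φ (n + 1)
  refine measurableSet_of_pre R fun x y hxy hx => ?_
  rw [Set.mem_preimage, Set.mem_singleton_iff] at hx ⊢
  rw [← hx]
  exact (Boundary.apply_eq_of_pre (hR x y hxy) (Nat.lt_succ_self n)).symm

lemma measurable_act {k : ℕ} (g : FreeGroup (Fin k)) : Measurable (act g) :=
  measurable_boundaryMap _

lemma act_injective {k : ℕ} (g : FreeGroup (Fin k)) : Function.Injective (act g) :=
  boundaryMap_injective _

/-- Left translation by a group element on the geodesics. -/
def actPair {k : ℕ} (g : FreeGroup (Fin k)) (p : Boundary2 k) : Boundary2 k :=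
  ⟨(act g p.1.1, act g p.1.2), (act_injective g).ne p.2⟩

lemma measurable_actPair {k : ℕ} (g : FreeGroup (Fin k)) : Measurable (actPair g) :=
  Measurable.subtype_mk (((measurable_act g).comp (measurable_fst.comp measurable_subtype_coe)).prodMk
    ((measurable_act g).comp (measurable_snd.comp measurable_subtype_coe)))

lemma PassesThrough.act {k : ℕ} {x y : Boundary k} {g h : FreeGroup (Fin k)}
    (H : PassesThrough x y g h) (v : FreeGroup (Fin k)) :
    PassesThrough (act v x) (act v y) (v * g) (v * h) := by
  obtain ⟨γ, hγ, i, j, hij, rfl, rfl⟩ := H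
  refine ⟨fun i => v * γ i, ⟨fun i j => ?_, hγ.tendsTo_left.act v, hγ.tendsTo_right.act v⟩,
    i, j, hij, rfl, rfl⟩
  rw [← hγ.dist_eq]
  exact congrArg _ (by group)

lemma actPair_preimage_cylinder {k : ℕ} (v g h : FreeGroup (Fin k)) :
    actPair v ⁻¹' cylinder g h = cylinder (v⁻¹ * g) (v⁻¹ * h) := by
  ext p
  constructor
  · intro H
    have := PassesThrough.act (show PassesThrough (act v p.1.1) (act v p.1.2) g h from H) v⁻¹
    rwa [act_inv_act, act_inv_act] at this
  · intro H
    have := PassesThrough.act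
      (show PassesThrough p.1.1 p.1.2 (v⁻¹ * g) (v⁻¹ * h) from H) v
    rwa [mul_inv_cancel_left, mul_inv_cancel_left] at this

/-! ### Rectangles generating the Borel sets of geodesics -/

/-- The cylinders of segments whose ends are incomparable as words, which are rectangles. -/
def incomparableCylinders (k : ℕ) : Set (Set (Boundary2 k)) :=
  {S | ∃ g h : FreeGroup (Fin k), ¬ g.toWord <+: h.toWord ∧ ¬ h.toWord <+: g.toWord ∧
    S = cylinder g h}

lemma mem_cylinder_iff {k : ℕ} {g h : FreeGroup (Fin k)} (h1 : ¬ g.toWord <+: h.toWord)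
    (h2 : ¬ h.toWord <+: g.toWord) (p : Boundary2 k) :
    p ∈ cylinder g h ↔ p.1.1.pre g.norm = g.toWord ∧ p.1.2.pre h.norm = h.toWord :=
  passesThrough_iff_of_not_prefix p.2 h1 h2

lemma pre_norm_iff_prefix {k : ℕ} {x : Boundary k} {g : FreeGroup (Fin k)} {n : ℕ}
    (h : g.norm ≤ n) : x.pre g.norm = g.toWord ↔ g.toWord <+: x.pre n :=
  ⟨fun e => e ▸ x.pre_prefix h, fun e => (x.eq_pre e).symm⟩

lemma pre_and_pre_iff {k : ℕ} {x : Boundary k} {g g' : FreeGroup (Fin k)}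
    (h : g.toWord <+: g'.toWord) :
    (x.pre g.norm = g.toWord ∧ x.pre g'.norm = g'.toWord) ↔ x.pre g'.norm = g'.toWord := by
  refine and_iff_right_of_imp fun e => ?_
  rw [pre_norm_iff_prefix h.length_le]
  change _ <+: x.pre g'.norm
  rwa [e]

lemma prefix_or_prefix_of_pre {k : ℕ} {x : Boundary k} {g g' : FreeGroup (Fin k)}
    (h : x.pre g.norm = g.toWord) (h' : x.pre g'.norm = g'.toWord) :
    g.toWord <+: g'.toWord ∨ g'.toWord <+: g.toWord := by
  rw [← h, ← h']
  exact (le_total g.norm g'.norm).imp x.pre_prefix x.pre_prefix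

/-- Two cones of rays that meet are nested, so in each coordinate the intersection is the smaller
cone. Incomparability survives because prefixes of comparable words are comparable. -/
lemma isPiSystem_incomparableCylinders (k : ℕ) : IsPiSystem (incomparableCylinders k) := by
  rintro _ ⟨g, h, h1, h2, rfl⟩ _ ⟨g', h', h1', h2', rfl⟩ ⟨p, hp, hp'⟩
  rw [mem_cylinder_iff h1 h2] at hp
  rw [mem_cylinder_iff h1' h2'] at hp'
  obtain ⟨u, hu1, hu2, hu⟩ : ∃ u : FreeGroup (Fin k), g.toWord <+: u.toWord ∧
      g'.toWord <+: u.toWord ∧ ∀ x : Boundary k, (x.pre g.norm = g.toWord ∧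
        x.pre g'.norm = g'.toWord) ↔ x.pre u.norm = u.toWord := by
    rcases prefix_or_prefix_of_pre hp.1 hp'.1 with e | e
    · exact ⟨g', e, List.prefix_rfl, fun x => pre_and_pre_iff e⟩
    · exact ⟨g, List.prefix_rfl, e, fun x => and_comm.trans (pre_and_pre_iff e)⟩
  obtain ⟨w, hw1, hw2, hw⟩ : ∃ u : FreeGroup (Fin k), h.toWord <+: u.toWord ∧
      h'.toWord <+: u.toWord ∧ ∀ x : Boundary k, (x.pre h.norm = h.toWord ∧
        x.pre h'.norm = h'.toWord) ↔ x.pre u.norm = u.toWord := by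
    rcases prefix_or_prefix_of_pre hp.2 hp'.2 with e | e
    · exact ⟨h', e, List.prefix_rfl, fun x => pre_and_pre_iff e⟩
    · exact ⟨h, List.prefix_rfl, e, fun x => and_comm.trans (pre_and_pre_iff e)⟩
  have a1 : ¬ u.toWord <+: w.toWord := fun e =>
    (List.prefix_or_prefix_of_prefix (hu1.trans e) hw1).elim h1 h2
  have a2 : ¬ w.toWord <+: u.toWord := fun e =>
    (List.prefix_or_prefix_of_prefix (hw1.trans e) hu1).elim h2 h1
  refine ⟨u, w, a1, a2, ?_⟩
  ext q
  rw [Set.mem_inter_iff, mem_cylinder_iff h1 h2, mem_cylinder_iff h1' h2', mem_cylinder_iff a1 a2,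
    ← hu, ← hw]
  tauto

/-- Every geodesic lies in an arbitrarily fine incomparable cylinder. -/
lemma exists_mem_cylinder {k : ℕ} (p : Boundary2 k) (n : ℕ) : ∃ g h : FreeGroup (Fin k),
    ¬ g.toWord <+: h.toWord ∧ ¬ h.toWord <+: g.toWord ∧ p ∈ cylinder g h ∧
      ∀ q ∈ cylinder g h, q.1.1.pre n = p.1.1.pre n ∧ q.1.2.pre n = p.1.2.pre n := by
  -- One letter beyond the branch point makes the two vertices incomparable; `n` gives the required
  -- fineness.
  set m := max n (branch p.1.1 p.1.2 + 1)
  have hne : p.1.1.pre m ≠ p.1.2.pre m := fun e => by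
    have := le_branch p.2 e
    omega
  have a1 : ¬ (p.1.1.vertex m).toWord <+: (p.1.2.vertex m).toWord := by
    rw [Boundary.toWord_vertex, Boundary.toWord_vertex]
    exact fun e => hne (e.eq_of_length (by simp [Boundary.pre_length]))
  have a2 : ¬ (p.1.2.vertex m).toWord <+: (p.1.1.vertex m).toWord := by
    rw [Boundary.toWord_vertex, Boundary.toWord_vertex]
    exact fun e => hne (e.eq_of_length (by simp [Boundary.pre_length])).symm
  refine ⟨_, _, a1, a2, ?_, ?_⟩
  · rw [mem_cylinder_iff a1 a2]
    simp [Boundary.norm_vertex, Boundary.toWord_vertex]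
  · intro q hq
    rw [mem_cylinder_iff a1 a2] at hq
    simp only [Boundary.norm_vertex, Boundary.toWord_vertex] at hq
    have hn : n ≤ m := le_max_left _ _
    constructor
    · rw [← q.1.1.pre_take hn, hq.1, Boundary.pre_take _ hn]
    · rw [← q.1.2.pre_take hn, hq.2, Boundary.pre_take _ hn]

/-- Such a set is the union of the incomparable cylinders it contains, by `exists_mem_cylinder`, and
the free group is countable. Close to the diagonal the cylinders must be longer than `n`. -/
lemma measurableSet_generateFrom_incomparableCylinders {k : ℕ} {S : Set (Boundary2 k)} (n : ℕ)
    (h : ∀ p ∈ S, ∀ q : Boundary2 k, q.1.1.pre n = p.1.1.pre n ∧ q.1.2.pre n = p.1.2.pre n →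
      q ∈ S) : MeasurableSet[MeasurableSpace.generateFrom (incomparableCylinders k)] S := by
  have : S = ⋃ u ∈ {u : FreeGroup (Fin k) × FreeGroup (Fin k) | ¬ u.1.toWord <+: u.2.toWord ∧
      ¬ u.2.toWord <+: u.1.toWord ∧ cylinder u.1 u.2 ⊆ S}, cylinder u.1 u.2 := by
    ext p
    simp only [Set.mem_iUnion, exists_prop]
    constructor
    · intro hp
      obtain ⟨g, h', h1, h2, h3, h4⟩ := exists_mem_cylinder p n
      exact ⟨(g, h'), ⟨h1, h2, fun q hq => h p hp q (h4 q hq)⟩, h3⟩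
    · rintro ⟨u, ⟨_, _, h1⟩, h2⟩
      exact h1 h2
  have hc : Countable (FreeGroup (Fin k)) := FreeGroup.toWord_injective.countable
  rw [this]
  refine MeasurableSet.biUnion (Set.to_countable _) fun u hu => ?_
  exact MeasurableSpace.measurableSet_generateFrom ⟨u.1, u.2, hu.1, hu.2.1, rfl⟩

lemma measurableSet_cylinder {k : ℕ} {g h : FreeGroup (Fin k)} (h1 : ¬ g.toWord <+: h.toWord)
    (h2 : ¬ h.toWord <+: g.toWord) : MeasurableSet (cylinder g h) := by
  have : cylinder g h = {p : Boundary2 k | p.1.1.pre g.norm = g.toWord} ∩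
      {p : Boundary2 k | p.1.2.pre h.norm = h.toWord} := by
    ext p
    exact mem_cylinder_iff h1 h2 p
  rw [this]
  exact ((measurable_fst.comp measurable_subtype_coe) (measurableSet_pre _ _)).inter
    ((measurable_snd.comp measurable_subtype_coe) (measurableSet_pre _ _))

lemma generateFrom_incomparableCylinders (k : ℕ) :
    (inferInstance : MeasurableSpace (Boundary2 k)) =
      MeasurableSpace.generateFrom (incomparableCylinders k) := by
  apply le_antisymm
  · have hval : Measurable[MeasurableSpace.generateFrom (incomparableCylinders k)]
        (Subtype.val : Boundary2 k → Boundary k × Boundary k) := by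
      -- The generated σ-algebra shadows the Borel instance, so that the measurability of the
      -- coordinates is tested against it.
      let _ : MeasurableSpace (Boundary2 k) :=
        MeasurableSpace.generateFrom (incomparableCylinders k)
      refine Measurable.prodMk (f := fun p : Boundary2 k => p.1.1)
        (g := fun p : Boundary2 k => p.1.2) ?_ ?_
      · refine Measurable.subtype_mk (f := fun p : Boundary2 k => p.1.1.1) ?_
        refine measurable_pi_lambda _ fun n => measurable_to_countable' fun a => ?_
        refine measurableSet_generateFrom_incomparableCylinders (n + 1) fun p hp q hq => ?_
        rw [Set.mem_preimage, Set.mem_singleton_iff] at hp ⊢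
        rw [← hp]
        exact Boundary.apply_eq_of_pre hq.1 (Nat.lt_succ_self n)
      · refine Measurable.subtype_mk (f := fun p : Boundary2 k => p.1.2.1) ?_
        refine measurable_pi_lambda _ fun n => measurable_to_countable' fun a => ?_
        refine measurableSet_generateFrom_incomparableCylinders (n + 1) fun p hp q hq => ?_
        rw [Set.mem_preimage, Set.mem_singleton_iff] at hp ⊢
        rw [← hp]
        exact Boundary.apply_eq_of_pre hq.2 (Nat.lt_succ_self n)
    rintro _ ⟨t, ht, rfl⟩
    exact hval ht
  · refine MeasurableSpace.generateFrom_le ?_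
    rintro _ ⟨g, h, h1, h2, rfl⟩
    exact measurableSet_cylinder h1 h2

lemma uniformCurrent_cylinder_ne_top {k : ℕ} {g h : FreeGroup (Fin k)} (hgh : g ≠ h) :
    uniformCurrent k (cylinder g h) ≠ ⊤ := by
  rw [uniformCurrent_cylinder hgh, ENNReal.inv_ne_top, Nat.cast_ne_zero]
  have hk : 0 < k := Nat.pos_of_ne_zero (by
    rintro rfl
    exact hgh (Subsingleton.elim _ _))
  have : 0 < 2 * k - 1 := by omega
  positivity

/-- The uniform current is invariant under left translation. -/
theorem measurePreserving_actPair {k : ℕ} (v : FreeGroup (Fin k)) :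
    MeasurePreserving (actPair v) (uniformCurrent k) (uniformCurrent k) := by
  refine ⟨measurable_actPair v, Eq.symm ?_⟩
  have hc : (incomparableCylinders k).Countable := by
    have hc : Countable (FreeGroup (Fin k)) := FreeGroup.toWord_injective.countable
    refine (Set.countable_range (fun u : FreeGroup (Fin k) × FreeGroup (Fin k) =>
      cylinder u.1 u.2)).mono ?_
    rintro _ ⟨g, h, _, _, rfl⟩
    exact ⟨(g, h), rfl⟩
  have hne : ∀ {g h : FreeGroup (Fin k)}, ¬ g.toWord <+: h.toWord → g ≠ h := by
    rintro g _ h1 rfl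
    exact h1 List.prefix_rfl
  -- The incomparable cylinders form a countable π-system of sets of finite mass that generates and
  -- covers; on them both measures agree, since translation does not change g⁻¹h.
  refine Measure.ext_of_generateFrom_of_cover_subset (generateFrom_incomparableCylinders k)
    (isPiSystem_incomparableCylinders k) subset_rfl hc ?_ ?_ ?_
  · refine Set.eq_univ_of_forall fun p => ?_
    obtain ⟨g, h, h1, h2, h3, _⟩ := exists_mem_cylinder p 0
    exact ⟨_, ⟨g, h, h1, h2, rfl⟩, h3⟩
  · rintro _ ⟨g, h, h1, h2, rfl⟩
    exact uniformCurrent_cylinder_ne_top (hne h1)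
  · rintro _ ⟨g, h, h1, h2, rfl⟩
    rw [Measure.map_apply (measurable_actPair v) (measurableSet_cylinder h1 h2),
      actPair_preimage_cylinder, uniformCurrent_cylinder (hne h1), uniformCurrent_cylinder]
    · congr 6
      group
    · exact (mul_right_injective v⁻¹).ne (hne h1)

/-! ### Finiteness and conjugation invariance of the length -/

lemma measurable_fst_boundary2 {k : ℕ} : Measurable fun p : Boundary2 k => p.1.1 :=
  measurable_fst.comp measurable_subtype_coe

lemma measurable_snd_boundary2 {k : ℕ} : Measurable fun p : Boundary2 k => p.1.2 :=
  measurable_snd.comp measurable_subtype_coe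

lemma measurable_apply {k : ℕ} (n : ℕ) : Measurable fun x : Boundary k => x.1 n :=
  (measurable_pi_apply n).comp measurable_subtype_coe

/-- The geodesics whose image under an automorphism passes through the identity. -/
def lengthSet {k : ℕ} (Φ : MulAut (FreeGroup (Fin k))) : Set (Boundary2 k) :=
  {p | (boundaryMap Φ p.1.1).1 0 ≠ (boundaryMap Φ p.1.2).1 0}

lemma measurableSet_lengthSet {k : ℕ} (Φ : MulAut (FreeGroup (Fin k))) :
    MeasurableSet (lengthSet Φ) :=
  (measurableSet_eq_fun
    ((measurable_apply 0).comp ((measurable_boundaryMap Φ).comp measurable_fst_boundary2))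
    ((measurable_apply 0).comp ((measurable_boundaryMap Φ).comp measurable_snd_boundary2))).compl

lemma autLength_eq {k : ℕ} (Φ : MulAut (FreeGroup (Fin k))) :
    autLength Φ = uniformCurrent k (lengthSet Φ) := by
  rw [autLength]
  congr 1
  ext p
  have hne := (boundaryMap_injective Φ).ne p.2
  rw [lengthSet, Set.mem_ofPred_eq, Set.mem_ofPred_eq, ← passesThrough_one_iff hne]
  constructor
  · rintro ⟨q, hq, e⟩
    have : PassesThrough q.1.1 q.1.2 1 1 := hq
    rwa [e] at this
  · intro h
    exact ⟨⟨(boundaryMap Φ p.1.1, boundaryMap Φ p.1.2), hne⟩, h, rfl⟩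

/-- By equivariance, passing from Φ to its conjugate pulls the length set back under translation by
Φ⁻¹(v), which preserves the current. -/
theorem autLength_conj_mul {k : ℕ} (v : FreeGroup (Fin k)) (Φ : MulAut (FreeGroup (Fin k))) :
    autLength (MulAut.conj v * Φ) = autLength Φ := by
  rw [autLength_eq, autLength_eq, ← (measurePreserving_actPair (Φ⁻¹ v)).measure_preimage
    (measurableSet_lengthSet Φ).nullMeasurableSet]
  congr 1
  ext p
  simp [lengthSet, actPair, boundaryMap_act, boundaryMap_conj_mul]

/-- Ends that agree on `R` letters have images with the same first letter. So pairs in the length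
set branch at depth at most `R`, where the density of the current is bounded, and the product
measure is finite. -/
theorem autLength_lt_top {k : ℕ} (Φ : MulAut (FreeGroup (Fin k))) : autLength Φ < ⊤ := by
  obtain ⟨R, hR⟩ := exists_pre_boundaryMap_congr Φ 1
  rw [autLength_eq, uniformCurrent, withDensity_apply _ (measurableSet_lengthSet Φ)]
  rcases Nat.eq_zero_or_pos k with rfl | hk
  · have : IsEmpty (Boundary2 0) := ⟨fun p => (p.1.1.1 0).1.elim0⟩
    rw [Set.eq_empty_of_isEmpty (lengthSet Φ)]
    simp
  have h1 : (1 : ℝ≥0∞) ≤ 2 * k - 1 := by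
    rw [rank_cast]
    exact_mod_cast (show 1 ≤ 2 * k - 1 by omega)
  have h2 : (2 * k - 1 : ℝ≥0∞) ≠ ⊤ := by
    rw [rank_cast]
    exact ENNReal.natCast_ne_top _
  refine (setLIntegral_mono measurable_const (g := fun _ => (2 * k / (2 * k - 1)) *
    (2 * k - 1 : ℝ≥0∞) ^ (2 * R)) fun p hp => ?_).trans_lt ?_
  · gcongr
    by_contra! hb
    exact hp (Boundary.apply_eq_of_pre (hR _ _ (branch_pre _ _ hb.le)) Nat.one_pos)
  · rw [setLIntegral_const, comap_val (measurableSet_ne k)]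
    refine ENNReal.mul_lt_top (ENNReal.mul_lt_top ?_ ?_) (measure_lt_top _ _)
    · exact ENNReal.div_lt_top (by finiteness) (zero_lt_one.trans_le h1).ne'
    · exact (ENNReal.pow_ne_top h2).lt_top

/-! ### The uniform frequency measure and single letters -/

instance {k : ℕ} [NeZero k] : IsProbabilityMeasure (uniformMeasure k) := ⟨uniformMeasure_univ⟩

lemma Boundary.pre_one {k : ℕ} (x : Boundary k) : x.pre 1 = [x.1 0] := by simp [pre]

lemma uniformMeasure_first {k : ℕ} (a : Fin k × Bool) :
    uniformMeasure k {x | x.1 0 = a} = ((2 * k : ℕ) : ℝ≥0∞)⁻¹ := by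
  have h := uniformMeasure_pre (n := 0) (FreeGroup.IsReduced.singleton (a := a)) rfl
  simpa [Boundary.pre_one] using h

/-- An initial segment of a letter times a ray is determined by a slightly longer one of the ray. -/
lemma pre_act_letter_congr {k : ℕ} (s : Fin k × Bool) {x y : Boundary k} {n : ℕ}
    (h : x.pre (n + 2) = y.pre (n + 2)) :
    (act (FreeGroup.mk [s]) x).pre (n + 1) = (act (FreeGroup.mk [s]) y).pre (n + 1) := by
  have hs : (FreeGroup.mk [s]).toWord = [s] := by simp [FreeGroup.toWord_mk]
  have hn : (FreeGroup.mk [s]).norm = 1 := by rw [FreeGroup.norm, hs]; rfl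
  have h0 : x.1 0 = y.1 0 := Boundary.apply_eq_of_pre h (by omega)
  -- Either `s` is prepended to the ray or it cancels its first letter. In the second case one
  -- letter is lost, which is why a longer initial segment is assumed.
  by_cases hr : s.1 = (x.1 0).1 → s.2 = (x.1 0).2
  · have key : ∀ z : Boundary k, z.1 0 = x.1 0 →
        (act (FreeGroup.mk [s]) z).pre (n + 1) = [s] ++ z.pre n := by
      intro z hz
      have := pre_act (g := FreeGroup.mk [s]) (x := z) (by
        rw [hs, hz]
        simpa [FreeGroup.IsReduced] using hr) n
      rwa [hn, hs, add_comm] at this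
    rw [key x rfl, key y h0.symm, ← x.pre_take (show n ≤ n + 2 by omega), h, Boundary.pre_take _ (by omega)]
  · push Not at hr
    have hx0 : x.1 0 = (s.1, !s.2) := by
      ext
      · exact congrArg Fin.val hr.1.symm
      · rcases s with ⟨a, b⟩
        cases b <;> simpa using hr.2.symm
    have e : FreeGroup.mk [s] = (FreeGroup.mk [(s.1, !s.2)])⁻¹ := by
      simp [FreeGroup.inv_mk, FreeGroup.invRev]
    have hs' : (FreeGroup.mk [(s.1, !s.2)]).toWord = [(s.1, !s.2)] := by simp [FreeGroup.toWord_mk]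
    have hn' : (FreeGroup.mk [(s.1, !s.2)]).norm = 1 := by rw [FreeGroup.norm, hs']; rfl
    have key : ∀ z : Boundary k, z.1 0 = x.1 0 → act (FreeGroup.mk [s]) z = z.drop 1 := by
      intro z hz
      rw [e, act_inv_of_pre, hn']
      rw [hn', hs', z.pre_one, hz, hx0]
    rw [key x rfl, key y h0.symm]
    rw [show n + 2 = 1 + (n + 1) by omega, x.pre_add, y.pre_add] at h
    exact List.append_inj_right h (by simp [Boundary.pre_length])

/-- Translation by a letter distorts the uniform frequency measure by a factor `2k - 1` at most. -/
theorem uniformMeasure_act_letter_le {k : ℕ} [NeZero k] (s : Fin k × Bool) {E : Set (Boundary k)}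
    {R : ℕ} (hE : ∀ x y : Boundary k, x.pre R = y.pre R → x ∈ E → y ∈ E) :
    uniformMeasure k {x | act (FreeGroup.mk [s]) x ∈ E} ≤
      ((2 * k - 1 : ℕ) : ℝ≥0∞) * uniformMeasure k E := by
  have hk : 0 < k := Nat.pos_of_ne_zero (NeZero.ne k)
  set W : Set (List (Fin k × Bool)) := {L | ∃ y ∈ E, y.pre (R + 2) = L} with hW
  have hEW : E = ⋃ L ∈ W, {x | x.pre (R + 2) = L} := by
    ext x
    simp only [Set.mem_iUnion, exists_prop]
    refine ⟨fun hx => ⟨_, ⟨x, hx, rfl⟩, rfl⟩, fun ⟨L, ⟨y, hy, h1⟩, h2⟩ => hE y x ?_ hy⟩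
    have h3 : x.pre (R + 2) = L := h2
    rw [← x.pre_take (Nat.le_add_right R 2), h3, ← h1, Boundary.pre_take _ (Nat.le_add_right R 2)]
  have hle : ∀ L ∈ W, uniformMeasure k {x | (act (FreeGroup.mk [s]) x).pre (R + 2) = L} ≤
      ((2 * k - 1 : ℕ) : ℝ≥0∞) * uniformMeasure k {x | x.pre (R + 2) = L} := by
    rintro L ⟨y, -, rfl⟩
    rw [uniformMeasure_pre (y.isReduced_pre _) (y.pre_length _)]
    -- Translating back by s⁻¹ determines all but the last of the `R + 2` letters. The cylinder of
    -- depth `R + 1` is `2k - 1` times heavier than one of depth `R + 2`.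
    calc uniformMeasure k {x | (act (FreeGroup.mk [s]) x).pre (R + 2) = y.pre (R + 2)}
        ≤ uniformMeasure k {x | x.pre (R + 1) = (act (FreeGroup.mk [s])⁻¹ y).pre (R + 1)} := by
          refine measure_mono fun x hx => ?_
          have e : (FreeGroup.mk [s])⁻¹ = FreeGroup.mk [(s.1, !s.2)] := by
            simp [FreeGroup.inv_mk, FreeGroup.invRev]
          have := pre_act_letter_congr (s.1, !s.2) (show _ = _ from hx)
          rwa [← e, act_inv_act] at this
      _ = ((2 * k * (2 * k - 1) ^ R : ℕ) : ℝ≥0∞)⁻¹ :=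
          uniformMeasure_pre (Boundary.isReduced_pre _ _) (Boundary.pre_length _ _)
      _ ≤ _ := by
          rw [pow_succ, ← mul_assoc, Nat.cast_mul _ (2 * k - 1),
            ENNReal.mul_inv (Or.inr (ENNReal.natCast_ne_top _)) (Or.inl (ENNReal.natCast_ne_top _)),
            mul_left_comm, ENNReal.mul_inv_cancel (by
              rw [Nat.cast_ne_zero]; omega) (ENNReal.natCast_ne_top _), mul_one]
  have hsub : {x | act (FreeGroup.mk [s]) x ∈ E} =
      ⋃ L ∈ W, {x | (act (FreeGroup.mk [s]) x).pre (R + 2) = L} := by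
    ext x
    have : act (FreeGroup.mk [s]) x ∈ E ↔
      act (FreeGroup.mk [s]) x ∈ ⋃ L ∈ W, {x : Boundary k | x.pre (R + 2) = L} := by rw [← hEW]
    simpa using this
  have hWc : W.Countable := Set.to_countable _
  rw [hsub]
  refine (measure_biUnion_le _ hWc _).trans ?_
  conv_rhs => rw [hEW]
  rw [measure_biUnion hWc _ fun L _ => measurableSet_pre _ _, ← ENNReal.tsum_mul_left]
  · exact ENNReal.tsum_le_tsum fun L => hle L L.2
  · intro L _ L' _ hne
    refine Set.disjoint_left.2 fun x hx hx' => hne ?_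
    rw [← show _ = L from hx, ← show _ = L' from hx']

/-! ### Counting the translates of a set that have intermediate measure -/

/-- At most one letter cannot be appended to a reduced word. -/
lemma exists_forall_isReduced_append {k : ℕ} [NeZero k] (g : FreeGroup (Fin k)) :
    ∃ b, ∀ s ≠ b, FreeGroup.IsReduced (g.toWord ++ [s]) := by
  rcases List.eq_nil_or_concat g.toWord with h | ⟨L, a, h⟩
  · exact ⟨(0, true), fun s _ => by rw [h]; exact FreeGroup.IsReduced.singleton⟩
  · refine ⟨(a.1, !a.2), fun s hs => ?_⟩
    rw [FreeGroup.IsReduced, List.isChain_append]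
    refine ⟨FreeGroup.isReduced_toWord, List.isChain_singleton _, ?_⟩
    rw [h]
    simp only [List.concat_eq_append, List.getLast?_append, List.getLast?_singleton, Option.some_or, Option.mem_def,
      Option.some.injEq, List.head?_cons]
    rintro _ rfl _ rfl h1
    by_contra h2
    apply hs
    ext
    · exact congrArg Fin.val h1.symm
    · rcases a with ⟨_, a⟩
      revert h2
      cases a <;> cases s.2 <;> simp

open Classical in
/-- The directions from the vertices of `G` away from the root which do not lead to other vertices
of `G`. -/
def freeDirections {k : ℕ} (G : Finset (FreeGroup (Fin k))) :
    Finset (FreeGroup (Fin k) × (Fin k × Bool)) :=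
  (G ×ˢ Finset.univ).filter fun p => FreeGroup.IsReduced (p.1.toWord ++ [p.2]) ∧
    ∀ h ∈ G, ¬ p.1.toWord ++ [p.2] <+: h.toWord

/-- Each vertex has at least 2k-1 ≥ 3 outward edges. An edge with vertices of `G` beyond it is
charged to a nearest one, `h`. No other edge is charged to `h`: both would lie on the path to `h`,
and the deeper one would start at a vertex of `G` beyond the other edge and nearer than `h`. So at
most |G| edges are blocked. -/
lemma card_le_card_freeDirections {k : ℕ} (hk : 2 ≤ k) (G : Finset (FreeGroup (Fin k))) :
    G.card ≤ (freeDirections G).card := by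
  classical
  have : NeZero k := ⟨by omega⟩
  set P := (G ×ˢ (Finset.univ : Finset (Fin k × Bool))).filter
    fun p => FreeGroup.IsReduced (p.1.toWord ++ [p.2]) with hP
  have hPcard : G.card * 3 ≤ P.card := by
    choose b hb using exists_forall_isReduced_append (k := k)
    have h1 : (G.sigma fun g => Finset.univ.erase (b g)).card ≤ P.card := by
      refine Finset.card_le_card_of_injOn (fun p => (p.1, p.2)) ?_ ?_
      · rintro ⟨g, s⟩ h
        simp only [Finset.coe_sigma, Set.mem_sigma_iff, Finset.mem_coe, Finset.mem_erase] at h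
        simp only [hP, Finset.coe_filter, Finset.mem_product, Finset.mem_univ, and_true,
          Set.mem_ofPred_eq]
        exact ⟨h.1, hb g s h.2.1⟩
      · rintro ⟨g, s⟩ _ ⟨g', s'⟩ _ h
        simp only [Prod.mk.injEq] at h
        obtain ⟨rfl, rfl⟩ := h
        rfl
    refine le_trans ?_ h1
    rw [Finset.card_sigma, ← smul_eq_mul]
    refine Finset.card_nsmul_le_sum _ _ _ fun g _ => ?_
    rw [Finset.card_erase_of_mem (Finset.mem_univ _)]
    simp only [Finset.card_univ, Fintype.card_prod, Fintype.card_fin, Fintype.card_bool]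
    omega
  have hsub : freeDirections G ⊆ P := by
    intro p hp
    simp only [freeDirections, hP, Finset.mem_filter] at hp ⊢
    exact ⟨hp.1, hp.2.1⟩
  have hrest : (P \ freeDirections G).card ≤ G.card := by
    have hex : ∀ p ∈ P \ freeDirections G, ∃ h ∈ G, p.1.toWord ++ [p.2] <+: h.toWord ∧
        ∀ h' ∈ G, p.1.toWord ++ [p.2] <+: h'.toWord → h.norm ≤ h'.norm := by
      intro p hp
      simp only [freeDirections, hP, Finset.mem_sdiff, Finset.mem_filter, not_and, not_forall,
        not_not] at hp
      obtain ⟨h0, h0G, h0p⟩ := hp.2 hp.1.1 hp.1.2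
      obtain ⟨h, hh, hmin⟩ := (G.filter fun h => p.1.toWord ++ [p.2] <+: h.toWord).exists_min_image
        FreeGroup.norm ⟨h0, Finset.mem_filter.2 ⟨h0G, h0p⟩⟩
      rw [Finset.mem_filter] at hh
      exact ⟨h, hh.1, hh.2, fun h' h1 h2 => hmin h' (Finset.mem_filter.2 ⟨h1, h2⟩)⟩
    choose! f hfG hfp hfmin using hex
    refine Finset.card_le_card_of_injOn f hfG ?_
    have key : ∀ p ∈ P \ freeDirections G, ∀ p' ∈ P \ freeDirections G, f p = f p' →
        p.1.norm ≤ p'.1.norm → p = p' := by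
      intro p hp p' hp' e hl
      have h1 := hfp p hp
      have h2 := hfp p' hp'
      rw [← e] at h2
      have h3 : p.1.toWord ++ [p.2] <+: p'.1.toWord ++ [p'.2] :=
        List.prefix_of_prefix_length_le h1 h2 (by
          simp only [FreeGroup.norm] at hl
          simpa using hl)
      rcases hl.eq_or_lt with hl | hl
      · have h4 := h3.eq_of_length (by
          simp only [FreeGroup.norm] at hl
          simpa using hl)
        have h5 := List.append_inj' h4 rfl
        exact Prod.ext (FreeGroup.toWord_injective h5.1) (by simpa using h5.2)
      · have h4 : p.1.toWord ++ [p.2] <+: p'.1.toWord :=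
          List.prefix_of_prefix_length_le h3 (List.prefix_append _ _) (by
            simp only [FreeGroup.norm] at hl
            simpa using hl)
        have hG : p'.1 ∈ G := by
          simp only [hP, Finset.mem_sdiff, Finset.mem_filter, Finset.mem_product] at hp'
          exact hp'.1.1.1
        have h5 := hfmin p hp _ hG h4
        have h6 := h2.length_le
        simp only [FreeGroup.norm] at h5
        simp only [List.length_append, List.length_singleton] at h6
        omega
    intro p hp p' hp' e
    rcases le_total p.1.norm p'.1.norm with hl | hl
    · exact key p hp p' hp' e hl
    · exact (key p' hp' p hp e.symm hl).symm
  have := Finset.card_sdiff_add_card_eq_card hsub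
  omega

/-! ### Geodesics with exactly one end in a set -/

/-- The geodesics entering the half-tree of the rays starting with `s`, and having exactly one end
in `D`. -/
def splitBy {k : ℕ} (D : Set (Boundary k)) (s : Fin k × Bool) : Set (Boundary2 k) :=
  {p | p.1.1.1 0 ≠ s ∧ p.1.2.1 0 = s ∧ ¬ (p.1.1 ∈ D ↔ p.1.2 ∈ D)}

lemma measurableSet_first {k : ℕ} (s : Fin k × Bool) :
    MeasurableSet {x : Boundary k | x.1 0 = s} :=
  measurable_apply 0 (measurableSet_singleton s)

lemma measurableSet_splitBy {k : ℕ} {D : Set (Boundary k)} (hD : MeasurableSet D)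
    (s : Fin k × Bool) : MeasurableSet (splitBy D s) := by
  have h1 := measurable_fst_boundary2 hD
  have h2 := measurable_snd_boundary2 hD
  have h3 := measurable_fst_boundary2 (measurableSet_first s)
  have h4 := measurable_snd_boundary2 (measurableSet_first s)
  have : splitBy D s = ((fun p : Boundary2 k => p.1.1) ⁻¹' {x | x.1 0 = s})ᶜ ∩
      (((fun p : Boundary2 k => p.1.2) ⁻¹' {x | x.1 0 = s}) ∩
      (symmDiff ((fun p : Boundary2 k => p.1.1) ⁻¹' D) ((fun p : Boundary2 k => p.1.2) ⁻¹' D))) := by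
    ext p
    simp only [splitBy, Set.mem_ofPred_eq, Set.mem_inter_iff, Set.mem_compl_iff, Set.mem_preimage,
      Set.mem_symmDiff]
    refine and_congr_right fun _ => and_congr_right fun _ => ?_
    tauto
  rw [this]
  exact h3.compl.inter (h4.inter (h1.symmDiff h2))

/-- Rays of which exactly one starts with `s` branch at depth 0, where the density is 2k/(2k-1) ≥ 1.
-/
lemma le_uniformCurrent_rect {k : ℕ} (hk : 0 < k) {D E : Set (Boundary k)} (hD : MeasurableSet D)
    (hE : MeasurableSet E) (s : Fin k × Bool) : 
    uniformMeasure k (D \ {x | x.1 0 = s}) * uniformMeasure k ({x | x.1 0 = s} ∩ E) ≤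
      uniformCurrent k {p | p.1.1 ∈ D \ {x | x.1 0 = s} ∧ p.1.2 ∈ {x | x.1 0 = s} ∩ E} := by
  rw [uniformCurrent_rect (j := 0) (hD.diff (measurableSet_first s))
    ((measurableSet_first s).inter hE)]
  · rw [mul_zero, pow_zero, mul_one]
    refine le_mul_of_one_le_left zero_le ?_
    rw [rank_cast, ENNReal.le_div_iff_mul_le]
    · rw [one_mul]
      exact_mod_cast Nat.sub_le _ _
    · left
      rw [Nat.cast_ne_zero]
      omega
    · left
      exact ENNReal.natCast_ne_top _
  · rintro x ⟨-, hx⟩ y ⟨hy, -⟩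
    refine branch_eq (by simp [Boundary.pre]) ?_
    rw [x.pre_one, y.pre_one]
    intro e
    exact hx ((List.singleton_inj.1 e).trans hy)

/-- The cone `S` of `s` has mass 1/(2k), so `D` or its complement has mass at least 1/(4k) inside
`S`. The opposite set either has mass at least δ/2 outside `S`, which gives the product
(δ/2)·1/(4k), or has mass at least δ/2 inside `S`, and then the roles of the two sets are exchanged.
-/
lemma le_uniformCurrent_splitBy {k : ℕ} (hk : 2 ≤ k) {D : Set (Boundary k)} (hD : MeasurableSet D)
    (s : Fin k × Bool) {δ : ℝ} (hδ : 0 ≤ δ) (h1 : ENNReal.ofReal δ ≤ uniformMeasure k D)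
    (h2 : ENNReal.ofReal δ ≤ uniformMeasure k Dᶜ) :
    ENNReal.ofReal (δ / (8 * k)) ≤ uniformCurrent k (splitBy D s) := by
  have : NeZero k := ⟨by omega⟩
  set S : Set (Boundary k) := {x | x.1 0 = s} with hS
  have hSm : MeasurableSet S := measurableSet_first s
  have ha := le_uniformCurrent_rect (by omega : 0 < k) hD hD.compl s
  have hb := le_uniformCurrent_rect (by omega : 0 < k) hD.compl hD s
  rw [← hS] at ha hb
  have hsa : {p : Boundary2 k | p.1.1 ∈ D \ S ∧ p.1.2 ∈ S ∩ Dᶜ} ⊆ splitBy D s := by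
    rintro p ⟨⟨h3, h4⟩, h5, h6⟩
    exact ⟨h4, h5, fun h => h6 (h.1 h3)⟩
  have hsb : {p : Boundary2 k | p.1.1 ∈ Dᶜ \ S ∧ p.1.2 ∈ S ∩ D} ⊆ splitBy D s := by
    rintro p ⟨⟨h3, h4⟩, h5, h6⟩
    exact ⟨h4, h5, fun h => h3 (h.2 h6)⟩
  replace ha := ha.trans (measure_mono hsa)
  replace hb := hb.trans (measure_mono hsb)
  set ν := uniformMeasure k with hν
  have hreal : ∀ E, ν E = ENNReal.ofReal (ν.real E) := fun E => by simp
  have e1 : ν.real D = ν.real (S ∩ D) + ν.real (D \ S) := by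
    rw [Set.inter_comm, measureReal_inter_add_sdiff hSm]
  have e2 : ν.real Dᶜ = ν.real (S ∩ Dᶜ) + ν.real (Dᶜ \ S) := by
    rw [Set.inter_comm, measureReal_inter_add_sdiff hSm]
  have e3 : ν.real S = ν.real (S ∩ D) + ν.real (S ∩ Dᶜ) := by
    rw [← measureReal_inter_add_sdiff (s := S) hD, Set.sdiff_eq]
  have e4 : ν.real D + ν.real Dᶜ = 1 := by
    rw [probReal_compl_eq_one_sub hD]; ring
  have e5 : ν.real S = 1 / (2 * k) := by
    rw [measureReal_def, hν, hS, uniformMeasure_first]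
    simp
  have hk' : (2 : ℝ) ≤ k := by exact_mod_cast hk
  have e6 : 1 / (2 * (k : ℝ)) ≤ 1 / 4 := by
    gcongr
    linarith
  have e7 : 1 / (2 * (k : ℝ)) = 2 * (1 / (4 * k)) := by field_simp; norm_num
  have e8 : δ / (8 * k) = (δ / 2) * (1 / (4 * k)) := by field_simp; ring
  have e9 : 0 < 1 / (4 * (k : ℝ)) := by positivity
  rw [hreal, ENNReal.ofReal_le_ofReal_iff measureReal_nonneg] at h1 h2
  rw [hreal, hreal (S ∩ _), ← ENNReal.ofReal_mul measureReal_nonneg] at ha hb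
  have key : δ / (8 * k) ≤ ν.real (D \ S) * ν.real (S ∩ Dᶜ) ∨
      δ / (8 * k) ≤ ν.real (Dᶜ \ S) * ν.real (S ∩ D) := by
    have p1 : 0 ≤ ν.real (D \ S) := measureReal_nonneg
    have p2 : 0 ≤ ν.real (Dᶜ \ S) := measureReal_nonneg
    have p3 : 0 ≤ ν.real (S ∩ D) := measureReal_nonneg
    have p4 : 0 ≤ ν.real (S ∩ Dᶜ) := measureReal_nonneg
    generalize ν.real (D \ S) = a at *
    generalize ν.real (Dᶜ \ S) = b at *
    generalize ν.real (S ∩ D) = c at *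
    generalize ν.real (S ∩ Dᶜ) = d at *
    generalize 1 / (4 * (k : ℝ)) = ε at *
    rw [e8]
    rcases le_total ε d with hd | hd
    · rcases le_total (δ / 2) a with h | h
      · left; gcongr
      · right
        -- The two lower bounds give δ ≤ 1/2. The complement of `S` has mass at least 3/4 and `a ≤
        -- δ/2 ≤ 1/4`, hence `b ≥ 1/2`; inside `S`, `c ≥ δ/2`.
        have : δ / 2 * ε ≤ (1 / 2) * (δ / 2) := by nlinarith
        refine this.trans (mul_le_mul ?_ ?_ (by linarith) p2) <;> linarith
    · rcases le_total (δ / 2) b with h | h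
      · right; gcongr; linarith
      · left
        have : δ / 2 * ε ≤ (1 / 2) * (δ / 2) := by nlinarith
        refine this.trans (mul_le_mul ?_ ?_ (by linarith) p1) <;> linarith
  rcases key with h | h
  · exact (ENNReal.ofReal_le_ofReal h).trans ha
  · exact (ENNReal.ofReal_le_ofReal h).trans hb

/-- The number of translates of `C` of intermediate measure is bounded by the mass of the geodesics
having exactly one end in `C`. -/
theorem card_mul_le_uniformCurrent {k : ℕ} (hk : 2 ≤ k) {C : Set (Boundary k)}
    (hC : MeasurableSet C) {δ : ℝ} (hδ : 0 ≤ δ) (G : Finset (FreeGroup (Fin k)))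
    (h1 : ∀ g ∈ G, ENNReal.ofReal δ ≤ uniformMeasure k (act g ⁻¹' C))
    (h2 : ∀ g ∈ G, ENNReal.ofReal δ ≤ uniformMeasure k (act g ⁻¹' C)ᶜ) :
    G.card * ENNReal.ofReal (δ / (8 * k)) ≤
      uniformCurrent k {p | ¬ (p.1.1 ∈ C ↔ p.1.2 ∈ C)} := by
  classical
  -- The geodesics that cross the edge leaving `p.1` in the direction `p.2` and have exactly one end
  -- in `C`, described after translating `p.1` to the identity.
  set Λ : FreeGroup (Fin k) × (Fin k × Bool) → Set (Boundary2 k) := fun p =>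
    actPair p.1⁻¹ ⁻¹' splitBy (act p.1 ⁻¹' C) p.2 with hΛ
  have hm : ∀ p : FreeGroup (Fin k) × (Fin k × Bool),
      MeasurableSet (splitBy (act p.1 ⁻¹' C) p.2) := fun p =>
    measurableSet_splitBy (measurable_act p.1 hC) p.2
  have hpre : ∀ p ∈ freeDirections G, ∀ q ∈ Λ p,
      q.1.2.pre (p.1.norm + 1) = p.1.toWord ++ [p.2] := by
    rintro p hp q ⟨-, hq, -⟩
    simp only [freeDirections, Finset.mem_filter] at hp
    have hq' : (act p.1⁻¹ q.1.2).1 0 = p.2 := hq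
    have := pre_act (g := p.1) (x := act p.1⁻¹ q.1.2) (by rw [hq']; exact hp.2.1) 1
    rwa [act_act_inv, Boundary.pre_one, hq'] at this
  -- The terminal end lies in the cone beyond the edge. Two such cones that meet are nested, and if
  -- the edges had different depths the deeper one would start beyond the other, which freeness
  -- excludes.
  have hdisj : ∀ p ∈ freeDirections G, ∀ p' ∈ freeDirections G, p.1.norm ≤ p'.1.norm →
      (∃ q, q ∈ Λ p ∧ q ∈ Λ p') → p = p' := by
    rintro p hp p' hp' hl ⟨q, hq, hq'⟩
    have e1 := hpre p hp q hq
    have e2 := hpre p' hp' q hq'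
    rcases hl.eq_or_lt with hl | hl
    · rw [← hl, e1] at e2
      have h5 := List.append_inj' e2 rfl
      exact Prod.ext (FreeGroup.toWord_injective h5.1) (by simpa using h5.2)
    · exfalso
      simp only [freeDirections, Finset.mem_filter, Finset.mem_product] at hp hp'
      refine hp.2.2 p'.1 hp'.1.1 ?_
      refine List.prefix_of_prefix_length_le (l₃ := p'.1.toWord ++ [p'.2]) ?_
        (List.prefix_append _ _) ?_
      · rw [← e1, ← e2]
        exact q.1.2.pre_prefix (by omega)
      · simp only [FreeGroup.norm] at hl
        simpa using hl
  calc (G.card : ℝ≥0∞) * ENNReal.ofReal (δ / (8 * k))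
      ≤ (freeDirections G).card * ENNReal.ofReal (δ / (8 * k)) := by
        gcongr
        exact card_le_card_freeDirections hk G
    _ ≤ ∑ p ∈ freeDirections G, uniformCurrent k (Λ p) := by
        rw [← nsmul_eq_mul]
        refine Finset.card_nsmul_le_sum _ _ _ fun p hp => ?_
        rw [show uniformCurrent k (Λ p) = _ from
          (measurePreserving_actPair _).measure_preimage (hm p).nullMeasurableSet]
        simp only [freeDirections, Finset.mem_filter, Finset.mem_product] at hp
        exact le_uniformCurrent_splitBy hk (measurable_act p.1 hC) p.2 hδ (h1 _ hp.1.1)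
          (h2 _ hp.1.1)
    _ = uniformCurrent k (⋃ p ∈ freeDirections G, Λ p) := by
        refine (measure_biUnion_finset (fun p hp p' hp' hne => ?_) fun p _ =>
          measurable_actPair _ (hm p)).symm
        refine Set.disjoint_left.2 fun q hq hq' => hne ?_
        rcases le_total p.1.norm p'.1.norm with hl | hl
        · exact hdisj p hp p' hp' hl ⟨q, hq, hq'⟩
        · exact (hdisj p' hp' p hp hl ⟨q, hq', hq⟩).symm
    _ ≤ _ := by
        refine measure_mono (Set.iUnion₂_subset fun p _ q hq => ?_)
        have := hq.2.2
        simpa only [actPair, Set.mem_preimage, act_act_inv, Set.mem_ofPred_eq] using this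

/-! ### Automorphisms of bounded length -/

lemma half_le_uniformMeasure_compl {k : ℕ} [NeZero k] {S : Set (Boundary k)}
    (hS : MeasurableSet S) (h : uniformMeasure k S ≤ 2⁻¹) : 2⁻¹ ≤ uniformMeasure k Sᶜ := by
  rw [prob_compl_eq_one_sub hS, ← ENNReal.one_sub_inv_two]
  exact tsub_le_tsub_left h _

lemma uniformMeasure_compl_le_half {k : ℕ} [NeZero k] {S : Set (Boundary k)}
    (hS : MeasurableSet S) (h : 2⁻¹ ≤ uniformMeasure k S) : uniformMeasure k Sᶜ ≤ 2⁻¹ := by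
  rw [prob_compl_eq_one_sub hS, ← ENNReal.one_sub_inv_two]
  exact tsub_le_tsub_left h _

/-- Every automorphism is conjugate to one whose image of the uniform frequency measure gives mass
at most `1 / 2` to every letter. -/
theorem exists_balanced {k : ℕ} [NeZero k] (Φ : MulAut (FreeGroup (Fin k))) :
    ∃ v : FreeGroup (Fin k), ∀ a,
      uniformMeasure k {x | (boundaryMap (MulAut.conj v * Φ) x).1 0 = a} ≤ 2⁻¹ := by
  have hk : 0 < k := Nat.pos_of_ne_zero (NeZero.ne k)
  set m : FreeGroup (Fin k) → ℝ≥0∞ := fun w =>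
    uniformMeasure k {x | (boundaryMap Φ x).pre w.norm = w.toWord} with hm
  obtain ⟨R, hR⟩ := exists_pre_boundaryMap_congr Φ⁻¹ 1
  -- By uniform continuity of Φ⁻¹, the preimage of a deep cone lies in the cone of a single letter,
  -- of mass 1/(2k).
  have hlong : ∀ w : FreeGroup (Fin k), R ≤ w.norm → m w ≤ 2⁻¹ := by
    intro w hw
    rcases Set.eq_empty_or_nonempty {x | (boundaryMap Φ x).pre w.norm = w.toWord} with h | ⟨y, hy⟩
    · rw [hm]
      simp only
      rw [h, measure_empty]
      exact zero_le
    · calc m w ≤ uniformMeasure k {x | x.1 0 = y.1 0} := by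
            refine measure_mono fun x hx => ?_
            have h1 : (boundaryMap Φ x).pre R = (boundaryMap Φ y).pre R := by
              rw [← Boundary.pre_take _ hw, show (boundaryMap Φ x).pre w.norm = _ from hx,
                ← show (boundaryMap Φ y).pre w.norm = _ from hy, Boundary.pre_take _ hw]
            have h2 := hR _ _ h1
            rw [← boundaryMap_mul, ← boundaryMap_mul, inv_mul_cancel, boundaryMap_one,
              boundaryMap_one] at h2
            exact Boundary.apply_eq_of_pre h2 Nat.one_pos
        _ = ((2 * k : ℕ) : ℝ≥0∞)⁻¹ := uniformMeasure_first _
        _ ≤ 2⁻¹ := by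
            rw [ENNReal.inv_le_inv]
            exact_mod_cast (by omega : 2 ≤ 2 * k)
  -- A deepest vertex whose cone carries more than half of the mass; the cone of the identity is a
  -- candidate, and `hlong` bounds the depth.
  obtain ⟨w, hw, hmax⟩ : ∃ w, 2⁻¹ < m w ∧ ∀ w', 2⁻¹ < m w' → w'.norm ≤ w.norm := by
    set N : Set ℕ := FreeGroup.norm '' {w | 2⁻¹ < m w} with hN
    have h1 : N.Nonempty := by
      refine ⟨_, 1, ?_, rfl⟩
      simp [hm, Boundary.pre]
    have h2 : BddAbove N := by
      refine ⟨R, ?_⟩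
      rintro _ ⟨w, hw, rfl⟩
      by_contra! h
      exact (hlong w h.le).not_gt hw
    obtain ⟨w, hw, e⟩ := Nat.sSup_mem h1 h2
    refine ⟨w, hw, fun w' hw' => ?_⟩
    rw [e]
    exact le_csSup h2 ⟨w', hw', rfl⟩
  refine ⟨w⁻¹, fun a => ?_⟩
  simp only [boundaryMap_conj_mul]
  -- Seen from `w`, a forward direction is the cone of a deeper vertex, light by maximality. The
  -- backward direction misses the cone of `w`, which has more than half of the mass.
  by_cases hr : FreeGroup.IsReduced (w.toWord ++ [a])
  · have hwa : (FreeGroup.mk (w.toWord ++ [a])).toWord = w.toWord ++ [a] := by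
      rw [FreeGroup.toWord_mk, hr.reduce_eq]
    have hn : (FreeGroup.mk (w.toWord ++ [a])).norm = w.norm + 1 := by
      rw [FreeGroup.norm, hwa]; simp [FreeGroup.norm]
    refine le_trans (measure_mono fun x hx => ?_) (not_lt.1 fun h =>
      absurd (hmax (FreeGroup.mk (w.toWord ++ [a])) h) (by omega))
    have hx' : (act w⁻¹ (boundaryMap Φ x)).1 0 = a := hx
    have := pre_act (g := w) (x := act w⁻¹ (boundaryMap Φ x)) (by rwa [hx']) 1
    rw [act_act_inv, Boundary.pre_one, hx'] at this
    rw [Set.mem_ofPred_eq, hn, hwa, this]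
  · have hsub : {x | (act w⁻¹ (boundaryMap Φ x)).1 0 = a} ⊆
        {x | (boundaryMap Φ x).pre w.norm = w.toWord}ᶜ := by
      intro x hx hx'
      apply hr
      have hx2 : (boundaryMap Φ x).pre w.norm = w.toWord := hx'
      rw [Set.mem_ofPred_eq, act_inv_of_pre hx2] at hx
      have := (boundaryMap Φ x).isReduced_pre (w.norm + 1)
      rwa [Boundary.pre_add, Boundary.pre_one, hx, hx2] at this
    exact (measure_mono hsub).trans (uniformMeasure_compl_le_half
      (measurable_boundaryMap Φ (measurableSet_pre _ _)) hw.le)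

/-- An automorphism balanced as in `exists_balanced` sends the letters to elements whose norm is
bounded in terms of its length. -/
theorem norm_letter_le {k : ℕ} (hk : 2 ≤ k) {Φ : MulAut (FreeGroup (Fin k))}
    (hΦ : ∀ a, uniformMeasure k {x | (boundaryMap Φ x).1 0 = a} ≤ 2⁻¹) (s : Fin k × Bool) :
    (Φ (FreeGroup.mk [s])).norm * ENNReal.ofReal ((2 * (2 * k - 1) : ℝ)⁻¹ / (8 * k)) ≤
      (2 * k) * autLength Φ := by
  classical
  have : NeZero k := ⟨by omega⟩
  set ν := uniformMeasure k with hν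
  set t := Φ (FreeGroup.mk [s]) with ht
  set δ : ℝ := (2 * (2 * k - 1))⁻¹ with hδ
  have hk' : (2 : ℝ) ≤ k := by exact_mod_cast hk
  have hδ0 : 0 ≤ δ := by rw [hδ, inv_nonneg]; linarith
  have hδE : ENNReal.ofReal δ = ((2 * k - 1 : ℕ) : ℝ≥0∞)⁻¹ * 2⁻¹ := by
    have e : δ = (((2 * k - 1 : ℕ) : ℝ))⁻¹ * 2⁻¹ := by
      rw [hδ, mul_inv, mul_comm, Nat.cast_sub (by omega)]
      push_cast
      rfl
    rw [e, ENNReal.ofReal_mul (by positivity), ENNReal.ofReal_inv_of_pos, ENNReal.ofReal_inv_of_pos]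
    · simp
    · norm_num
    · exact_mod_cast (by omega : 0 < 2 * k - 1)
  have hδ2 : ENNReal.ofReal δ ≤ 2⁻¹ := by
    rw [hδE]
    refine mul_le_of_le_one_left zero_le ?_
    rw [ENNReal.inv_le_one]
    exact_mod_cast (by omega : 1 ≤ 2 * k - 1)
  -- Since Φ(sx) = tΦ(x), the ray Φ(sx) starts with `t` unless Φ(x) starts with the one letter `b`
  -- that may cancel against `t`. Such exceptions have mass at most 1/2 by balance, and translation
  -- by `s` costs a factor `2k - 1`; hence the value of δ.
  have hcone : ENNReal.ofReal δ ≤ ν {x | (boundaryMap Φ x).pre t.norm = t.toWord} := by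
    obtain ⟨b, hb⟩ := exists_forall_isReduced_append t
    set E := {x | (act t⁻¹ (boundaryMap Φ x)).1 0 ≠ b} with hE
    have h1 : E ⊆ {x | (boundaryMap Φ x).pre t.norm = t.toWord} := by
      intro x hx
      have := pre_act (g := t) (hb _ hx) 0
      rw [act_act_inv] at this
      simpa [Boundary.pre] using this
    have h2 : {x | act (FreeGroup.mk [s]) x ∈ E} = {x | (boundaryMap Φ x).1 0 = b}ᶜ := by
      ext x
      simp [hE, boundaryMap_act, ← ht, act_inv_act]
    have h3 : ν {x | act (FreeGroup.mk [s]) x ∈ E} ≤ ((2 * k - 1 : ℕ) : ℝ≥0∞) * ν E := by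
      obtain ⟨R, hR⟩ := exists_pre_boundaryMap_congr (MulAut.conj t⁻¹ * Φ) 1
      refine uniformMeasure_act_letter_le s (R := R) fun x y hxy hx => ?_
      have := Boundary.apply_eq_of_pre (hR x y hxy) Nat.one_pos
      rw [boundaryMap_conj_mul, boundaryMap_conj_mul] at this
      rwa [hE, Set.mem_ofPred_eq, ← this]
    have h4 : 2⁻¹ ≤ ν {x | (boundaryMap Φ x).1 0 = b}ᶜ :=
      half_le_uniformMeasure_compl (measurable_boundaryMap Φ (measurableSet_first b)) (hΦ b)
    refine le_trans ?_ (measure_mono h1)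
    rw [h2] at h3
    rw [hδE, ENNReal.inv_mul_le_iff (by rw [Nat.cast_ne_zero]; omega) (ENNReal.natCast_ne_top _)]
    exact h4.trans h3
  let v : ℕ → FreeGroup (Fin k) := fun i => FreeGroup.mk (t.toWord.take i)
  have hv : ∀ i, (v i).toWord = t.toWord.take i := fun i => toWord_mk_of_prefix (List.take_prefix _ _)
  have hvn : ∀ i < t.norm, (v i).norm = i := by
    intro i hi
    rw [FreeGroup.norm, hv, List.length_take]
    exact min_eq_left (le_of_lt hi)
  let C : Fin k × Bool → Set (Boundary k) := fun a => {x | (boundaryMap Φ x).1 0 = a}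
  have hact : ∀ i a, act (Φ⁻¹ (v i)⁻¹) ⁻¹' C a = {x | (act (v i)⁻¹ (boundaryMap Φ x)).1 0 = a} := by
    intro i a
    ext x
    simp only [C, Set.mem_preimage, Set.mem_ofPred_eq, boundaryMap_act, MulAut.apply_inv_self]
  -- If Φ(x) starts with `t`, removing the prefix `v i` puts the next letter of `t` in front.
  have hlow : ∀ i (hi : i < t.toWord.length),
      ENNReal.ofReal δ ≤ ν (act (Φ⁻¹ (v i)⁻¹) ⁻¹' C t.toWord[i]) := by
    intro i hi
    refine hcone.trans (measure_mono fun x hx => ?_)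
    have hx' : (boundaryMap Φ x).pre t.norm = t.toWord := hx
    rw [hact, Set.mem_ofPred_eq, act_inv_of_pre, hvn i hi]
    · simp only [← hx', Boundary.pre, Boundary.drop]
      simp
    · rw [hvn i hi, hv, ← hx', Boundary.pre_take _ (show i ≤ t.norm from hi.le)]
  have hupp : ∀ i (hi : i < t.toWord.length),
      ENNReal.ofReal δ ≤ ν (act (Φ⁻¹ (v i)⁻¹) ⁻¹' C t.toWord[i])ᶜ := by
    intro i hi
    have h0 : 0 < t.toWord.length := by omega
    -- The cone of `v i` extended by the next letter of `t` lies in the cone of the first letter of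
    -- `t`, which is light by balance.
    have hle : ν (act (Φ⁻¹ (v i)⁻¹) ⁻¹' C t.toWord[i]) ≤ 2⁻¹ := by
      refine le_trans (measure_mono fun x hx => ?_) (hΦ t.toWord[0])
      rw [hact, Set.mem_ofPred_eq] at hx
      have htake : (v i).toWord ++ [t.toWord[i]] = t.toWord.take (i + 1) := by
        rw [hv, List.take_append_getElem]
      have := pre_act (g := v i) (x := act (v i)⁻¹ (boundaryMap Φ x)) (by
        rw [hx, htake]
        exact FreeGroup.isReduced_toWord.infix (List.take_prefix _ _).isInfix) 1
      rw [act_act_inv, Boundary.pre_one, hx, htake, hvn i hi] at this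
      have h2 := congrArg (List.take 1) this
      rw [Boundary.pre_take _ (by omega), Boundary.pre_one, List.take_take,
        min_eq_left (by omega), List.take_one, List.head?_eq_getElem?,
        List.getElem?_eq_getElem h0] at h2
      simpa using h2
    exact hδ2.trans (half_le_uniformMeasure_compl
      (measurable_act _ (measurable_boundaryMap Φ (measurableSet_first _))) hle)
  -- Prefixes followed by the same letter `a` give translates of the single set `C a` by distinct
  -- elements, and a pair with exactly one end in `C a` belongs to the length set. Summing over the
  -- letters gives the factor `2k`.
  have hletter : ∀ a, ((Finset.univ.filter fun i : Fin t.toWord.length => t.toWord[i] = a).card : ℝ≥0∞) *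
      ENNReal.ofReal (δ / (8 * k)) ≤ autLength Φ := by
    intro a
    set I := Finset.univ.filter fun i : Fin t.toWord.length => t.toWord[i] = a with hI
    have hinj : Set.InjOn (fun i : Fin t.toWord.length => Φ⁻¹ (v i)⁻¹) I := by
      intro i _ j _ e
      have e2 := congrArg FreeGroup.norm (inv_injective (Φ⁻¹.injective e))
      rw [hvn i i.2, hvn j j.2] at e2
      exact Fin.ext e2
    rw [← Finset.card_image_of_injOn hinj]
    refine (card_mul_le_uniformCurrent hk (C := C a)
      (measurable_boundaryMap Φ (measurableSet_first a)) hδ0 _ ?_ ?_).trans ?_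
    · intro g hg
      obtain ⟨i, hi, rfl⟩ := Finset.mem_image.1 hg
      rw [hI, Finset.mem_filter] at hi
      have := hlow i i.2
      rwa [show t.toWord[(i : ℕ)] = a from hi.2] at this
    · intro g hg
      obtain ⟨i, hi, rfl⟩ := Finset.mem_image.1 hg
      rw [hI, Finset.mem_filter] at hi
      have := hupp i i.2
      rwa [show t.toWord[(i : ℕ)] = a from hi.2] at this
    · rw [autLength_eq]
      refine measure_mono fun p hp h => hp ?_
      simp only [C, Set.mem_ofPred_eq]
      rw [h]
  have hcard : t.norm = ∑ a, (Finset.univ.filter fun i : Fin t.toWord.length => t.toWord[i] = a).card := by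
    rw [← Finset.card_eq_sum_card_fiberwise (fun _ _ => Finset.mem_coe.2 (Finset.mem_univ _)),
      Finset.card_univ, Fintype.card_fin]
    rfl
  rw [hcard, Nat.cast_sum, Finset.sum_mul]
  refine (Finset.sum_le_card_nsmul _ _ _ fun a _ => hletter a).trans ?_
  rw [nsmul_eq_mul]
  simp [mul_comm]

/-! ### Finiteness of the set of outer classes of bounded length -/

lemma finite_norm_le (k R : ℕ) : {g : FreeGroup (Fin k) | g.norm ≤ R}.Finite := by
  refine Set.Finite.of_finite_image (f := FreeGroup.toWord) ?_ FreeGroup.toWord_injective.injOn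
  refine (List.finite_length_le (Fin k × Bool) R).subset ?_
  rintro _ ⟨g, hg, rfl⟩
  exact hg

lemma finite_mulAut_of_norm_le (k R : ℕ) :
    {Φ : MulAut (FreeGroup (Fin k)) | ∀ a, (Φ (FreeGroup.of a)).norm ≤ R}.Finite := by
  refine Set.Finite.of_finite_image (f := fun Φ a => Φ (FreeGroup.of a)) ?_ ?_
  · refine (Set.Finite.pi' fun _ : Fin k => finite_norm_le k R).subset ?_
    rintro _ ⟨Φ, hΦ, rfl⟩
    exact hΦ
  · intro Φ _ Ψ _ h
    have : Φ.toMonoidHom = Ψ.toMonoidHom := FreeGroup.ext_hom _ _ fun a => congrFun h a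
    ext x
    exact DFunLike.congr_fun this x

/-- For the ranks where the tree does not branch: the group is cyclic, and its automorphisms are the
units of `ZMod n`, with `n = 0` in the infinite case. -/
lemma finite_mulAut_of_le_one {k : ℕ} (hk : k ≤ 1) : Finite (MulAut (FreeGroup (Fin k))) := by
  have : IsCyclic (FreeGroup (Fin k)) := by
    rcases Nat.le_one_iff_eq_zero_or_eq_one.1 hk with rfl | rfl
    · infer_instance
    · refine ⟨⟨FreeGroup.of 0, fun g => ?_⟩⟩
      change g ∈ Subgroup.zpowers _
      induction g using FreeGroup.induction_on with
      | C1 => exact Subgroup.one_mem _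
      | of a =>
        rw [Subsingleton.elim a 0]
        exact Subgroup.mem_zpowers _
      | inv_of a h => exact Subgroup.inv_mem _ h
      | mul a b ha hb => exact Subgroup.mul_mem _ ha hb
  exact Finite.of_equiv _ (IsCyclic.mulAutMulEquiv (FreeGroup (Fin k))).symm.toEquiv

/-- The quotient consists of left cosets, so the conjugation is moved to the right of Φ, where it
becomes conjugation by Φ⁻¹(v). -/
lemma mk_conj_mul {k : ℕ} (v : FreeGroup (Fin k)) (Φ : MulAut (FreeGroup (Fin k))) :
    (QuotientGroup.mk (MulAut.conj v * Φ) : Out k) = QuotientGroup.mk Φ := by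
  rw [eq_comm, QuotientGroup.eq]
  refine ⟨Φ⁻¹ v, ?_⟩
  ext x
  simp

lemma exists_conj_mul_eq {k : ℕ} {Φ Ψ : MulAut (FreeGroup (Fin k))}
    (h : (QuotientGroup.mk Φ : Out k) = QuotientGroup.mk Ψ) : ∃ v, MulAut.conj v * Φ = Ψ := by
  rw [QuotientGroup.eq] at h
  obtain ⟨v, hv⟩ := h
  refine ⟨Φ v, ?_⟩
  rw [← mul_inv_cancel_left Φ Ψ, ← hv]
  ext x
  simp

/-- There are finitely many outer classes of bounded length. -/
theorem finite_autLength_lt {k : ℕ} {M : ℝ≥0∞} (hM : M ≠ ⊤) :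
    {c : Out k | ∃ Φ : MulAut (FreeGroup (Fin k)),
      (QuotientGroup.mk Φ : Out k) = c ∧ autLength Φ < M}.Finite := by
  rcases Nat.lt_or_ge k 2 with hk | hk
  · have := finite_mulAut_of_le_one (Nat.lt_succ_iff.1 hk)
    exact Set.toFinite _
  have : NeZero k := ⟨by omega⟩
  set c := ENNReal.ofReal ((2 * (2 * k - 1) : ℝ)⁻¹ / (8 * k)) with hc
  have hc0 : c ≠ 0 := by
    have hk' : (2 : ℝ) ≤ k := by exact_mod_cast hk
    rw [hc, ← pos_iff_ne_zero, ENNReal.ofReal_pos]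
    have : (0 : ℝ) < 2 * k - 1 := by linarith
    positivity
  obtain ⟨R, hR⟩ := ENNReal.exists_nat_gt (r := 2 * k * M / c)
    (ENNReal.div_ne_top (by finiteness) hc0)
  refine ((finite_mulAut_of_norm_le k R).image fun Φ => (QuotientGroup.mk Φ : Out k)).subset ?_
  rintro _ ⟨Φ, rfl, hΦ⟩
  -- The balanced representative has the same outer class and the same length, and `R` bounds the
  -- norms of its values on the basis.
  obtain ⟨v, hv⟩ := exists_balanced Φ
  refine ⟨MulAut.conj v * Φ, fun a => ?_, mk_conj_mul v Φ⟩
  have h1 := norm_letter_le hk hv (a, true)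
  rw [autLength_conj_mul, ← hc] at h1
  have h2 : ((MulAut.conj v * Φ) (FreeGroup.of a)).norm * c ≤ 2 * k * M :=
    h1.trans (by gcongr)
  rw [← ENNReal.le_div_iff_mul_le (Or.inl hc0) (Or.inl ENNReal.ofReal_ne_top)] at h2
  exact_mod_cast (h2.trans hR.le)

/-! ### Cyclic length and extraction of subsequences -/

/-- Growth of powers: the norm of hⁿ is at least n times the cyclic length of h, while hⁿ = vgⁿv⁻¹
has norm at most 2|v| + n|g|. A cyclic length above |g| is contradicted at n = 2|v| + 1. -/
lemma cyclicLength_conj_le {k : ℕ} (v g : FreeGroup (Fin k)) :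
    cyclicLength (v * g * v⁻¹) ≤ g.norm := by
  set h := v * g * v⁻¹ with hh
  have hpow : ∀ (u : FreeGroup (Fin k)) (n : ℕ), (u ^ n).norm ≤ n * u.norm := by
    intro u n
    induction n with
    | zero => simp
    | succ n ih =>
      rw [pow_succ, add_mul, one_mul]
      exact (FreeGroup.norm_mul_le _ _).trans (by omega)
  have hlow : ∀ n, (n + 1) * cyclicLength h ≤ (h ^ (n + 1)).norm := by
    intro n
    conv_rhs => rw [← h.mk_toWord, FreeGroup.pow_mk, FreeGroup.norm, FreeGroup.toWord_mk,
      FreeGroup.reduceCyclically.reduce_flatten_replicate_succ FreeGroup.isReduced_toWord]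
    simp only [List.length_append, List.length_flatten, List.map_replicate, List.sum_replicate,
      smul_eq_mul, cyclicLength]
    omega
  have hupp : ∀ n, (h ^ (n + 1)).norm ≤ 2 * v.norm + (n + 1) * g.norm := by
    intro n
    rw [hh, conj_pow]
    have h1 := FreeGroup.norm_mul_le (v * g ^ (n + 1)) v⁻¹
    have h2 := FreeGroup.norm_mul_le v (g ^ (n + 1))
    have h3 := hpow g (n + 1)
    rw [FreeGroup.norm_inv_eq] at h1
    omega
  by_contra! hlt
  have h1 := (hlow (2 * v.norm)).trans (hupp (2 * v.norm))
  have h2 : (2 * v.norm + 1) * (g.norm + 1) ≤ (2 * v.norm + 1) * cyclicLength h :=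
    Nat.mul_le_mul_left _ hlt
  rw [mul_add, mul_one] at h2
  omega

/-- A sequence whose lengths do not tend to infinity has a subsequence in a single outer class. -/
lemma exists_subseq_mk_eq {k : ℕ} {Φ : ℕ → MulAut (FreeGroup (Fin k))}
    (h : ¬ Tendsto (fun n => autLength (Φ n)) atTop (𝓝 ⊤)) :
    ∃ φ : ℕ → ℕ, StrictMono φ ∧ ∃ v : ℕ → FreeGroup (Fin k),
      ∃ Θ, ∀ n, MulAut.conj (v n) * Φ (φ n) = Θ := by
  rw [ENNReal.tendsto_nhds_top_iff_nnreal] at h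
  push Not at h
  obtain ⟨M, hM⟩ := h
  -- Infinitely many lengths are at most `M`; the bound `M + 1` makes the inequality strict.
  -- Finitely many classes then share infinitely many indices, so one of them recurs.
  have hfin := finite_autLength_lt (k := k) (M := M + 1) (by finiteness)
  obtain ⟨c, hc⟩ : ∃ c : Out k, ∃ᶠ n in atTop, (QuotientGroup.mk (Φ n) : Out k) = c := by
    by_contra! hcon
    refine hM ?_
    filter_upwards [(Set.Finite.eventually_all hfin).2 fun c _ => hcon c] with n hn hle
    exact hn _ ⟨Φ n, rfl, hle.trans_lt (ENNReal.lt_add_right (by finiteness) one_ne_zero)⟩ rfl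
  obtain ⟨φ, hφ, hφc⟩ := extraction_of_frequently_atTop hc
  choose v hv using fun n => exists_conj_mul_eq ((hφc n).trans (hφc 0).symm)
  exact ⟨φ, hφ, v, _, hv⟩

end

end FreeLength

/-! ### The length compactness theorem -/

open FreeLength in
theorem theorem1p1 (k : ℕ) :
    -- every sequence has a subsequence that is constant up to conjugation or of length going to `∞`
    (∀ Φ : ℕ → MulAut (FreeGroup (Fin k)),
      ∃ φ : ℕ → ℕ, StrictMono φ ∧ ∃ v : ℕ → FreeGroup (Fin k),
        (∃ Θ, ∀ n, MulAut.conj (v n) * Φ (φ n) = Θ) ∨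
        Tendsto (fun n => autLength (Φ (φ n))) atTop (𝓝 ⊤)) ∧
    -- the two alternatives exclude each other, for any subsequence and any conjugating elements
    (∀ (Φ : ℕ → MulAut (FreeGroup (Fin k))) (φ : ℕ → ℕ) (v : ℕ → FreeGroup (Fin k)),
      StrictMono φ →
      ¬ ((∃ Θ, ∃ ψ : ℕ → ℕ, StrictMono ψ ∧
            ∀ i, MulAut.conj (v (ψ i)) * Φ (φ (ψ i)) = Θ) ∧
          Tendsto (fun n => autLength (Φ (φ n))) atTop (𝓝 ⊤))) ∧
    -- there are finitely many outer classes of bounded length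
    (∀ M : ℝ, {c : Out k | ∃ Φ : MulAut (FreeGroup (Fin k)),
      (QuotientGroup.mk Φ : Out k) = c ∧ autLength Φ < ENNReal.ofReal M}.Finite) ∧
    -- unbounded stretching of one word forces the length to go to `∞`
    (∀ (Φ : ℕ → MulAut (FreeGroup (Fin k))) (w : FreeGroup (Fin k)),
      Tendsto (fun n => cyclicLength (Φ n w)) atTop atTop →
      Tendsto (fun n => autLength (Φ n)) atTop (𝓝 ⊤)) := by
  refine ⟨fun Φ => ?_, fun Φ φ v hφ => ?_, fun M => finite_autLength_lt ENNReal.ofReal_ne_top,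
    fun Φ w hw => ?_⟩
  · by_cases h : Tendsto (fun n => autLength (Φ n)) atTop (𝓝 ⊤)
    · exact ⟨id, strictMono_id, fun _ => 1, Or.inr h⟩
    · obtain ⟨φ, hφ, v, hv⟩ := exists_subseq_mk_eq h
      exact ⟨φ, hφ, v, Or.inl hv⟩
  · rintro ⟨⟨Θ, ψ, hψ, h⟩, hlim⟩
    have h1 := hlim.comp hψ.tendsto_atTop
    -- Along `ψ` the length is constantly that of `Θ`, which is finite.
    have h2 : (fun n => autLength (Φ (φ n))) ∘ ψ = fun _ => autLength Θ := by
      funext i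
      rw [← h i, autLength_conj_mul]
      rfl
    rw [h2] at h1
    exact (autLength_lt_top Θ).ne (tendsto_nhds_unique tendsto_const_nhds h1)
  · by_contra hcon
    -- Along this subsequence the images of `w` are conjugate to `Θ w`, so their cyclic lengths are
    -- at most the norm of `Θ w`.
    obtain ⟨φ, hφ, v, Θ, h⟩ := exists_subseq_mk_eq hcon
    obtain ⟨n, hn⟩ := ((hw.comp hφ.tendsto_atTop).eventually_gt_atTop (Θ w).norm).exists
    have h1 := cyclicLength_conj_le (v n)⁻¹ (Θ w)
    rw [← h n] at h1 hn
    simp only [MulAut.mul_apply, MulAut.conj_apply, Function.comp_apply] at h1 hn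
    rw [show (v n)⁻¹ * (v n * Φ (φ n) w * (v n)⁻¹) * (v n)⁻¹⁻¹ = Φ (φ n) w by group] at h1
    omega
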